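/- For real $\lambda>-\tfrac12$ and an integer $n\ge 0$ let $$C_n^{(\lambda)}(x)=\frac{(2\lambda)_n}{(\lambda+\frac12)_n}\,P_n^{(\lambda-\frac12,\lambda-\frac12)}(x)$$ be the Gegenbauer polynomial, where $(a)_k=a(a+1)\cdots(a+k-1)$ and $P_n^{(a,b)}(x)=\frac{(a+1)_n}{n!}\,{}_2F_1\big(-n,\,n+a+b+1;\,a+1;\,\tfrac{1-x}{2}\big)$ is the Jacobi polynomial, and let $$E(C_n^{(\lambda)})=-\int_{-1}^1 \big(C_n^{(\lambda)}(x)\big)^2\log\big(C_n^{(\lambda)}(x)\big)^2\,(1-x^2)^{\lambda-\frac12}\,dx$$ be its information entropy (with $0\log 0=0$). Put $$c_n^{(\lambda)}=\frac{2^{2-2\lambda}\,\Gamma(n+2\lambda)}{\Gamma(\lambda)\,\Gamma(n+\lambda+1)},\qquad \alpha_{\nu,n}^{(\lambda)}=\frac{(1-\lambda)_\nu\,(n+1)_\nu}{\nu!\,(n+\lambda+1)_\nu},$$ $$d_{m,n}^{(\lambda)}=\frac{(\lambda)_m(\lambda)_{n-m}}{m!\,(n-m)!}\ \ (0\le m\le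 n),\qquad d_{m,n}^{(\lambda)}=0\ \text{ for all other integers } m,$$ and, for a positive integer $\lambda$, $$\beta_{m,n}^{(\lambda)}=\sum_{\nu=0}^{\lambda-1}\alpha_{\nu,n}^{(\lambda)}\big(d_{m-\nu,n}^{(\lambda)}-d_{m-\nu-1,n}^{(\lambda)}\big)\ \ (1\le m\le n+\lambda-1),\qquad \beta_{n+\lambda,n}^{(\lambda)}=-\alpha_{\lambda-1,n}^{(\lambda)}d_{n,n}^{(\lambda)}.$$ Then for every integer $\lambda\ge 4$ and every integer $n\ge 0$ the integral $E(C_n^{(\lambda)})$ converges and $$\begin{aligned} E(C_n^{(\lambda)})=-\frac{\pi}{2}\,c_n^{(\lambda)}\Bigg\{&2\alpha_{0,n}^{(\lambda)}d_{0,n}^{(\lambda)}\log\Big(\frac{(\lambda)_n}{n!}\Big)+\alpha_{0,n}^{(\lambda)}d_{n,n}^{(\lambda)}+(2\lambda-1)\sum_{m=1}^{n+\lambda}\frac{\beta_{m,n}^{(\lambda)}}{m}\\ &-\sum_{m=1}^{n+\lambda}\sum_{k=1}^{m}\sum_{k_6=0}^{\lfloor m/3\rfloor}\sum_{k_8=0}^{\lfloor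 m/4\rfloor}\cdots\sum_{k_{2(\lambda-1)}=0}^{\lfloor m/(\lambda-1)\rfloor}\beta_{m,n}^{(\lambda)}\Big(\frac{\alpha_{\lambda-3,n}^{(\lambda)}}{\alpha_{\lambda-2,n}^{(\lambda)}}\Big)^{m}\Big(-\frac{(\alpha_{\lambda-2,n}^{(\lambda)})^2}{\alpha_{\lambda-1,n}^{(\lambda)}\alpha_{\lambda-3,n}^{(\lambda)}}\Big)^{k}\\ &\quad\times\frac{(k-1)!}{\big(2k-m+\sum_{r=1}^{\lambda-3}r\,k_{2r+4}\big)!\,\big(m-k-\sum_{s=1}^{\lambda-3}(s+1)k_{2s+4}\big)!}\\ &\quad\times\prod_{j=3}^{\lambda-1}\frac{1}{(k_{2j})!}\Big(\frac{\alpha_{\lambda-1-j,n}^{(\lambda)}\,(\alpha_{\lambda-2,n}^{(\lambda)})^{j-2}}{(\alpha_{\lambda-3,n}^{(\lambda)})^{j-1}}\Big)^{k_{2j}}\Bigg\}, \end{aligned}$$ where the reciprocal of the factorial of a negative integer is understood to be $0$. -/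

import Mathlib

open scoped Nat

noncomputable section

namespace GegenbauerEntropy

/-- The Pochhammer symbol `(a)_n = a (a+1) ⋯ (a+n-1)`. -/
def poch (a : ℝ) (n : ℕ) : ℝ := (ascPochhammer ℝ n).eval a

/-- The Jacobi polynomial `P_n^{(a,b)}(x)`, through the (terminating) Gauss hypergeometric series. -/
def jacobi (a b : ℝ) (n : ℕ) (x : ℝ) : ℝ :=
  poch (a + 1) n / (n ! : ℝ) *
    ordinaryHypergeometric (-(n : ℝ)) ((n : ℝ) + a + b + 1) (a + 1) ((1 - x) / 2)

/-- The Gegenbauer polynomial `C_n^{(lam)}(x)`. -/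
def gegenbauer (lam : ℝ) (n : ℕ) (x : ℝ) : ℝ :=
  poch (2 * lam) n / poch (lam + 1 / 2) n * jacobi (lam - 1 / 2) (lam - 1 / 2) n x

/-- The integrand `C_n^{(lam)}(x)^2 log (C_n^{(lam)}(x)^2) (1 - x^2)^{lam - 1/2}`. At the zeros of
the polynomial it is `0`, in accordance with `0 log 0 = 0`. -/
def entropyIntegrand (lam : ℝ) (n : ℕ) (x : ℝ) : ℝ :=
  gegenbauer lam n x ^ 2 * Real.log (gegenbauer lam n x ^ 2) * (1 - x ^ 2) ^ (lam - 1 / 2)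

/-- The information entropy `E(C_n^{(lam)})`. -/
def entropy (lam : ℝ) (n : ℕ) : ℝ := -∫ x in (-1 : ℝ)..1, entropyIntegrand lam n x

/-- The constant `c_n^{(lam)}` of the Szegő representation. -/
def szegoC (lam : ℝ) (n : ℕ) : ℝ :=
  2 ^ (2 - 2 * lam) * Real.Gamma (n + 2 * lam) / (Real.Gamma lam * Real.Gamma (n + lam + 1))

/-- The Szegő coefficient `α_{ν,n}^{(lam)}`. -/
def alpha (lam : ℝ) (n ν : ℕ) : ℝ :=
  poch (1 - lam) ν * poch (n + 1) ν / ((ν ! : ℝ) * poch (n + lam + 1) ν)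

/-- The standard coefficient `d_{m,n}^{(lam)} = (lam)_m (lam)_{n-m} / (m! (n-m)!)` for
`0 ≤ m ≤ n`, which vanishes for the other indices (the reciprocal of the factorial of a
negative integer is zero). -/
def coeffD (lam : ℝ) (n : ℕ) (m : ℤ) : ℝ :=
  if 0 ≤ m ∧ m ≤ n then
    poch lam m.toNat * poch lam (n - m).toNat / ((m.toNat ! : ℝ) * ((n - m).toNat ! : ℝ))
  else 0

/-- The coefficient `β_{m,n}^{(lam)}`, with the separate convention for `m = n + lam`. -/
def beta (lam n m : ℕ) : ℝ :=
  if m = n + lam then -(alpha lam n (lam - 1) * coeffD lam n n)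
  else ∑ ν ∈ Finset.range lam,
    alpha lam n ν * (coeffD lam n ((m : ℤ) - ν) - coeffD lam n ((m : ℤ) - ν - 1))

/-- The reciprocal `1 / z!` for an integer `z`, equal to zero if `z < 0`. -/
def invFact (z : ℤ) : ℝ := if 0 ≤ z then 1 / (z.toNat ! : ℝ) else 0

end GegenbauerEntropy

end

open GegenbauerEntropy

/-! ### Gegenbauer polynomials on the unit circle and the zero-free disc. -/

namespace GegenbauerEntropy

open Polynomial

/-! Write z = exp(2iθ), D(z) = ∑ d_m z^m and A(z) = ∑ α_ν z^ν, and let A* be A with its coefficients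
reversed. Then C_n(cos θ) = exp(-inθ) D(z), so log C_n² = 2 log |D(z)|. For integer λ Szegő's series
terminates and becomes the polynomial identity (z - 1)^(2λ-1) D = const · (z^(n+λ) A - A*)
(`szego_identity`). On the circle it turns the weighted square sin^(2λ) θ · C_n² into a multiple of
Re((1 - z) D A), a cosine polynomial with coefficients β_m. The entropy is thus a combination, with
weights β_m, of the Fourier cosine coefficients of log |D| (`entropy_eq_sum`).

D has no zero in the open unit disc (`aeval_trigPoly_ne_zero`): D(w²) = w^n f_n, where f_n solves
the Gegenbauer recurrence at (w + 1/w)/2, a point that avoids (-1, 1) when 0 < |w| < 1. Hence D =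
d_0 ∏ (1 - a z) with |a| ≤ 1, and the Fourier coefficients of log |D| are read off from the power
series of D'/D (`integral_cos_mul_log_norm_aeval`).

Szegő's identity also computes D'/D up to degree n + λ - 1. There (1 - z)^(2λ-1) D is a constant
times A* minus a term divisible by z^(n+λ). The factor (1 - z)^(2λ-1) yields the sum of β_m/m.
Expanding the logarithm of A*, normalized, by the multinomial theorem yields the multiple sum. The
term z^(n+λ) A affects only the last coefficient and yields α_0 d_n (`coeff_logDeriv_trigPoly`). -/

theorem poch_zero (a : ℝ) : poch a 0 = 1 := by simp [poch]

theorem poch_succ (a : ℝ) (k : ℕ) : poch a (k + 1) = poch a k * (a + k) := by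
  simp [poch, ascPochhammer_succ_eval]

theorem poch_succ_left (a : ℝ) (k : ℕ) : poch a (k + 1) = a * poch (a + 1) k := by
  simp [poch, ascPochhammer_succ_left, eval_comp]

theorem poch_pos {a : ℝ} (ha : 0 < a) (k : ℕ) : 0 < poch a k := ascPochhammer_pos k a ha

theorem poch_neg_natCast_of_lt {n k : ℕ} (h : n < k) : poch (-(n : ℝ)) k = 0 :=
  ascPochhammer_eval_neg_coe_nat_of_lt h

/-- The coefficient of `((1 - x) / 2) ^ k` in the Gegenbauer polynomial. -/
noncomputable def gegenbauerCoeff (l : ℝ) (n k : ℕ) : ℝ :=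
  poch (2 * l) n / (n ! : ℝ) * (poch (-(n : ℝ)) k * poch (n + 2 * l) k
    / ((k ! : ℝ) * poch (l + 1 / 2) k))

/-- The factor (-n)_k kills every term with k > n. The length N is left free so that polynomials of
different degree can be summed over a common range. -/
theorem gegenbauer_eq_sum {l : ℝ} (hl : 0 < l) (n N : ℕ) (hN : n < N) (x : ℝ) :
    gegenbauer l n x = ∑ k ∈ Finset.range N, gegenbauerCoeff l n k * ((1 - x) / 2) ^ k := by
  have h1 : poch (l + 1 / 2) n ≠ 0 := (poch_pos (by positivity) n).ne'
  have h2 : l - 1 / 2 + 1 = l + 1 / 2 := by ring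
  have h3 : (n : ℝ) + (l - 1 / 2) + (l - 1 / 2) + 1 = n + 2 * l := by ring
  rw [gegenbauer, jacobi, ordinaryHypergeometric_eq_tsum, h2, h3]
  dsimp only
  rw [tsum_eq_sum (s := Finset.range N), Finset.mul_sum, Finset.mul_sum]
  · refine Finset.sum_congr rfl fun k _ => ?_
    have h4 : poch (l + 1 / 2) k ≠ 0 := (poch_pos (by positivity) k).ne'
    rw [gegenbauerCoeff]
    rw [← poch, ← poch, ← poch, smul_eq_mul]
    generalize poch (l + 1 / 2) k = q at *
    generalize poch (l + 1 / 2) n = r at *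
    field_simp
  · intro k hk
    have : n < k := by simp at hk; omega
    rw [ascPochhammer_eval_neg_coe_nat_of_lt this]
    simp

theorem gegenbauerCoeff_succ_right {l : ℝ} (hl : 0 < l) (n k : ℕ) :
    gegenbauerCoeff l n (k + 1) * ((l + 1 / 2 + k) * (k + 1)) =
      gegenbauerCoeff l n k * ((k - n) * (n + 2 * l + k)) := by
  have h4 : poch (l + 1 / 2) k ≠ 0 := (poch_pos (by positivity) k).ne'
  have h5 : (n ! : ℝ) ≠ 0 := by positivity
  have h6 : (k ! : ℝ) ≠ 0 := by positivity
  have h7 : l + 1 / 2 + (k : ℝ) ≠ 0 := by positivity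
  have h8 : (k : ℝ) + 1 ≠ 0 := by positivity
  simp only [gegenbauerCoeff, poch_succ, Nat.factorial_succ, Nat.cast_mul, Nat.cast_add,
    Nat.cast_one]
  field_simp
  ring

/-- Kept free of division, since n + 1 - k vanishes at k = n + 1. -/
theorem gegenbauerCoeff_succ_left {l : ℝ} (hl : 0 < l) (n k : ℕ) :
    gegenbauerCoeff l (n + 1) k * (n + 1 - k) = gegenbauerCoeff l n k * (2 * l + n + k) := by
  have h4 : poch (l + 1 / 2) k ≠ 0 := (poch_pos (by positivity) k).ne'
  have h5 : (n ! : ℝ) ≠ 0 := by positivity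
  have h6 : (k ! : ℝ) ≠ 0 := by positivity
  have h8 : (n : ℝ) + 1 ≠ 0 := by positivity
  have h9 : (2 * l + n) ≠ 0 := by positivity
  have e1 : poch (-((n : ℝ) + 1)) k * (n + 1 - k) = (n + 1) * poch (-(n : ℝ)) k := by
    have a := poch_succ (-((n : ℝ) + 1)) k
    have b := poch_succ_left (-((n : ℝ) + 1)) k
    rw [show -((n : ℝ) + 1) + 1 = -n by ring] at b
    linear_combination a - b
  have e2 : poch ((n : ℝ) + 1 + 2 * l) k * (2 * l + n) = poch (n + 2 * l) k * (n + 2 * l + k) := by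
    have a := poch_succ ((n : ℝ) + 2 * l) k
    have b := poch_succ_left ((n : ℝ) + 2 * l) k
    rw [show (n : ℝ) + 2 * l + 1 = n + 1 + 2 * l by ring] at b
    linear_combination a - b
  simp only [gegenbauerCoeff, poch_succ, Nat.factorial_succ, Nat.cast_mul, Nat.cast_add,
    Nat.cast_one]
  generalize poch (l + 1 / 2) k = q at *
  field_simp
  linear_combination poch (2 * l) n * ((poch ((n : ℝ) + 1 + 2 * l) k * (2 * l + n)) * e1 +
    (n + 1) * poch (-(n : ℝ)) k * e2)

theorem gegenbauerCoeff_succ_succ {l : ℝ} (hl : 0 < l) (n k : ℕ) :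
    gegenbauerCoeff l (n + 1) (k + 1) * ((l + 1 / 2 + k) * (k + 1)) =
      -(gegenbauerCoeff l n k * ((2 * l + n + k) * (n + 1 + 2 * l + k))) := by
  have h1 := gegenbauerCoeff_succ_right hl (n + 1) k
  have h2 := gegenbauerCoeff_succ_left hl n k
  push_cast at h1
  linear_combination h1 - (n + 1 + 2 * l + k) * h2

theorem gegenbauerCoeff_rec_zero {l : ℝ} (hl : 0 < l) (n : ℕ) :
    (n + 2) * gegenbauerCoeff l (n + 2) 0 =
      2 * (n + 1 + l) * gegenbauerCoeff l (n + 1) 0 - (n + 2 * l) * gegenbauerCoeff l n 0 := by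
  have h1 := gegenbauerCoeff_succ_left hl n 0
  have h2 := gegenbauerCoeff_succ_left hl (n + 1) 0
  push_cast at h1 h2
  linear_combination h2 - h1

/-- With x = 1 - 2s, multiplication by x replaces the coefficient a_(k+1) by a_(k+1) - 2 a_k. All
terms are reduced to multiples of `gegenbauerCoeff l (n + 1) k`. -/
theorem gegenbauerCoeff_rec_succ {l : ℝ} (hl : 0 < l) (n k : ℕ) :
    (n + 2) * gegenbauerCoeff l (n + 2) (k + 1) =
      2 * (n + 1 + l) * (gegenbauerCoeff l (n + 1) (k + 1) - 2 * gegenbauerCoeff l (n + 1) k)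
        - (n + 2 * l) * gegenbauerCoeff l n (k + 1) := by
  have h1 := gegenbauerCoeff_succ_succ hl (n + 1) k
  have h2 := gegenbauerCoeff_succ_right hl (n + 1) k
  have h3 := gegenbauerCoeff_succ_left hl n (k + 1)
  have h7 : l + 1 / 2 + (k : ℝ) ≠ 0 := by positivity
  have h8 : (k : ℝ) + 1 ≠ 0 := by positivity
  have h9 : 2 * l + n + (k + 1) ≠ 0 := by positivity
  push_cast at h1 h2 h3
  have h4 : gegenbauerCoeff l n (k + 1) * ((l + 1 / 2 + k) * (k + 1)) =
      gegenbauerCoeff l (n + 1) k * ((k - (n + 1)) * (n - k)) := by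
    apply mul_right_cancel₀ h9
    linear_combination (-(l + 1 / 2 + (k : ℝ)) * (k + 1)) * h3 + (n - k) * h2
  apply mul_right_cancel₀ (mul_ne_zero h7 h8)
  linear_combination (n + 2) * h1 - 2 * (n + 1 + l) * h2 + (n + 2 * l) * h4

theorem gegenbauer_rec {l : ℝ} (hl : 0 < l) (n : ℕ) (x : ℝ) :
    (n + 2) * gegenbauer l (n + 2) x =
      2 * (n + 1 + l) * x * gegenbauer l (n + 1) x - (n + 2 * l) * gegenbauer l n x := by
  obtain ⟨s, rfl⟩ : ∃ s, x = 1 - 2 * s := ⟨(1 - x) / 2, by ring⟩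
  have hs : (1 - (1 - 2 * s)) / 2 = s := by ring
  -- Two expansions of the same polynomial: the shifted one for itself, the unshifted `e1'` for its
  -- product with s.
  have e1 : gegenbauer l (n + 1) (1 - 2 * s) =
      ∑ k ∈ Finset.range (n + 3), gegenbauerCoeff l (n + 1) (k + 1) * s ^ (k + 1)
        + gegenbauerCoeff l (n + 1) 0 := by
    rw [gegenbauer_eq_sum hl (n + 1) (n + 4) (by omega), hs, Finset.sum_range_succ']
    simp
  have e1' : gegenbauer l (n + 1) (1 - 2 * s) =
      ∑ k ∈ Finset.range (n + 3), gegenbauerCoeff l (n + 1) k * s ^ k := by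
    rw [gegenbauer_eq_sum hl (n + 1) (n + 3) (by omega), hs]
  have e2 : gegenbauer l (n + 2) (1 - 2 * s) =
      ∑ k ∈ Finset.range (n + 3), gegenbauerCoeff l (n + 2) (k + 1) * s ^ (k + 1)
        + gegenbauerCoeff l (n + 2) 0 := by
    rw [gegenbauer_eq_sum hl (n + 2) (n + 4) (by omega), hs, Finset.sum_range_succ']
    simp
  have e0 : gegenbauer l n (1 - 2 * s) =
      ∑ k ∈ Finset.range (n + 3), gegenbauerCoeff l n (k + 1) * s ^ (k + 1)
        + gegenbauerCoeff l n 0 := by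
    rw [gegenbauer_eq_sum hl n (n + 4) (by omega), hs, Finset.sum_range_succ']
    simp
  have key : (n + 2) * ∑ k ∈ Finset.range (n + 3), gegenbauerCoeff l (n + 2) (k + 1) * s ^ (k + 1)
      = 2 * (n + 1 + l) *
        (∑ k ∈ Finset.range (n + 3), gegenbauerCoeff l (n + 1) (k + 1) * s ^ (k + 1)
        - 2 * s * ∑ k ∈ Finset.range (n + 3), gegenbauerCoeff l (n + 1) k * s ^ k)
        - (n + 2 * l) * ∑ k ∈ Finset.range (n + 3), gegenbauerCoeff l n (k + 1) * s ^ (k + 1) := by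
    simp only [Finset.mul_sum, ← Finset.sum_sub_distrib]
    refine Finset.sum_congr rfl fun k _ => ?_
    linear_combination s ^ (k + 1) * gegenbauerCoeff_rec_succ hl n k
  rw [e2, e0]
  have h0 := gegenbauerCoeff_rec_zero hl n
  linear_combination key + h0 - 2 * (n + 1 + l) * (e1 - 2 * s * e1')

theorem gegenbauer_zero {l : ℝ} (hl : 0 < l) (x : ℝ) : gegenbauer l 0 x = 1 := by
  rw [gegenbauer_eq_sum hl 0 1 (by norm_num)]
  simp [gegenbauerCoeff, poch_zero]

theorem gegenbauer_one {l : ℝ} (hl : 0 < l) (x : ℝ) : gegenbauer l 1 x = 2 * l * x := by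
  have h7 : l + 1 / 2 ≠ 0 := by positivity
  rw [gegenbauer_eq_sum hl 1 2 (by norm_num)]
  simp only [Finset.sum_range_succ, gegenbauerCoeff, poch_zero, poch_succ]
  simp
  field_simp
  ring

theorem continuous_gegenbauer {l : ℝ} (hl : 0 < l) (n : ℕ) : Continuous (gegenbauer l n) := by
  rw [funext (gegenbauer_eq_sum hl n (n + 1) (by omega))]
  fun_prop

/-- The polynomial `∑ d_m X ^ m` with `C_n(cos θ) = exp (-i n θ) ∑ d_m exp (2 i m θ)`. -/
noncomputable def trigPoly (l : ℝ) (n : ℕ) : ℝ[X] :=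
  ∑ m ∈ Finset.range (n + 1), C (coeffD l n m) * X ^ m

theorem coeffD_of_lt (l : ℝ) {n m : ℕ} (h : n < m) : coeffD l n m = 0 := by
  rw [coeffD, if_neg]; omega

theorem coeffD_add (l : ℝ) (j k : ℕ) :
    coeffD l (j + k) j = poch l j / (j ! : ℝ) * (poch l k / (k ! : ℝ)) := by
  rw [coeffD, if_pos (by omega)]
  have : ((j + k : ℕ) - (j : ℤ)).toNat = k := by omega
  rw [this, Int.toNat_natCast]
  field_simp

theorem coeff_trigPoly (l : ℝ) (n m : ℕ) : (trigPoly l n).coeff m = coeffD l n m := by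
  simp only [trigPoly, finsetSum_coeff, coeff_C_mul, coeff_X_pow, mul_ite, mul_one, mul_zero]
  rw [Finset.sum_ite_eq, ite_eq_left_iff]
  intro h
  rw [coeffD_of_lt]
  simpa [Nat.lt_succ_iff] using h

theorem natDegree_trigPoly_le (l : ℝ) (n : ℕ) : (trigPoly l n).natDegree ≤ n := by
  rw [natDegree_le_iff_coeff_eq_zero]
  intro m hm
  rw [coeff_trigPoly, coeffD_of_lt _ hm]

/-- The symmetry of d under m ↔ n - m. On the unit circle it relates D to its complex conjugate. -/
theorem reflect_trigPoly (l : ℝ) (n : ℕ) : (trigPoly l n).reflect n = trigPoly l n := by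
  ext m
  rw [coeff_reflect, coeff_trigPoly, coeff_trigPoly]
  rcases le_or_gt m n with h | h
  · obtain ⟨k, rfl⟩ := Nat.exists_eq_add_of_le h
    rw [revAt_le h, Nat.add_sub_cancel_left, coeffD_add, Nat.add_comm m k, coeffD_add, mul_comm]
  · rw [revAt_eq_self_of_lt h]

theorem coeffD_rec {l : ℝ} (n m : ℕ) :
    (n + 2) * coeffD l (n + 2) (m + 1 : ℕ) = (n + 1 + l) *
      (coeffD l (n + 1) (m + 1 : ℕ) + coeffD l (n + 1) m) - (n + 2 * l) * coeffD l n m := by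
  have ha : ∀ k : ℕ, poch l (k + 1) / ((k + 1)! : ℝ) = poch l k / (k ! : ℝ) * ((l + k) / (k + 1)) := by
    intro k
    rw [poch_succ, Nat.factorial_succ]
    push_cast
    field_simp
  -- Beyond the range of d the identity is trivial, except at m = n + 1, where two leading
  -- coefficients survive.
  rcases lt_or_ge n m with h | h
  · rw [coeffD_of_lt l h, coeffD_of_lt l (show n + 1 < m + 1 by omega)]
    rcases (show n + 1 = m ∨ n + 1 < m by omega) with rfl | h
    · have e1 := coeffD_add l (n + 2) 0
      have e2 := coeffD_add l (n + 1) 0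
      rw [add_zero] at e1 e2
      rw [show n + 1 + 1 = n + 2 by rfl, e1, e2, ha (n + 1)]
      push_cast
      field_simp
      ring
    · rw [coeffD_of_lt l h, coeffD_of_lt l (show n + 2 < m + 1 by omega)]
      ring
  · obtain ⟨k, rfl⟩ := Nat.exists_eq_add_of_le h
    have e1 := coeffD_add l (m + 1) (k + 1)
    have e2 := coeffD_add l (m + 1) k
    have e3 := coeffD_add l m (k + 1)
    have e4 := coeffD_add l m k
    rw [show m + 1 + (k + 1) = m + k + 2 by ring] at e1
    rw [show m + 1 + k = m + k + 1 by ring] at e2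
    rw [show m + (k + 1) = m + k + 1 by ring] at e3
    rw [e1, e2, e3, e4, ha, ha]
    push_cast
    field_simp
    ring

theorem coeffD_rec_zero {l : ℝ} (n : ℕ) :
    (n + 2) * coeffD l (n + 2) (0 : ℕ) = (n + 1 + l) * coeffD l (n + 1) (0 : ℕ) := by
  have e1 := coeffD_add l 0 (n + 2)
  have e2 := coeffD_add l 0 (n + 1)
  rw [zero_add] at e1 e2
  rw [e1, e2, poch_succ, Nat.factorial_succ]
  push_cast
  field_simp
  ring

/-- The Gegenbauer recurrence after x = (w + 1/w)/2 and X = w², with the powers of w cleared. -/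
theorem trigPoly_rec (l : ℝ) (n : ℕ) :
    C (n + 2 : ℝ) * trigPoly l (n + 2) = C (n + 1 + l) * ((1 + X) * trigPoly l (n + 1))
      - C (n + 2 * l) * (X * trigPoly l n) := by
  ext m
  rw [coeff_sub, coeff_C_mul, coeff_C_mul, coeff_C_mul, add_mul 1 X, one_mul, coeff_add]
  rcases m with _ | m
  · simp only [coeff_X_mul_zero, coeff_trigPoly]
    linear_combination coeffD_rec_zero (l := l) n
  · simp only [coeff_X_mul, coeff_trigPoly]
    linear_combination coeffD_rec (l := l) n m

theorem trigPoly_zero (l : ℝ) : trigPoly l 0 = 1 := by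
  simp [trigPoly, coeffD, poch_zero]

theorem trigPoly_one (l : ℝ) : trigPoly l 1 = C l * (1 + X) := by
  simp [trigPoly, coeffD, poch_zero, poch_succ, Finset.sum_range_succ]
  ring

/-- The sequence `w⁻ⁿ D_n(w²)`. -/
noncomputable def trigVal (l : ℝ) (w : ℂ) (n : ℕ) : ℂ := w⁻¹ ^ n * aeval (w ^ 2) (trigPoly l n)

theorem trigVal_zero (l : ℝ) (w : ℂ) : trigVal l w 0 = 1 := by simp [trigVal, trigPoly_zero]

theorem trigVal_one (l : ℝ) {w : ℂ} (hw : w ≠ 0) :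
    trigVal l w 1 = 2 * l * ((w + w⁻¹) / 2) := by
  simp [trigVal, trigPoly_one]
  field_simp
  ring

theorem trigVal_rec (l : ℝ) {w : ℂ} (hw : w ≠ 0) (n : ℕ) :
    (n + 2) * trigVal l w (n + 2) =
      2 * (n + 1 + l) * ((w + w⁻¹) / 2) * trigVal l w (n + 1) - (n + 2 * l) * trigVal l w n := by
  have h := congrArg (fun p => aeval (w ^ 2) p) (trigPoly_rec l n)
  simp only [map_mul, map_sub, map_add, aeval_C, aeval_X, map_one, Complex.coe_algebraMap,
    Complex.ofReal_natCast, Complex.ofReal_ofNat] at h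
  simp only [trigVal, inv_pow, pow_succ]
  field_simp
  linear_combination h

/-- Both sides have the same two initial values and satisfy the same three-term recurrence. -/
theorem gegenbauer_cos {l : ℝ} (hl : 0 < l) (θ : ℝ) (n : ℕ) :
    (gegenbauer l n (Real.cos θ) : ℂ) = trigVal l (Complex.exp (θ * Complex.I)) n := by
  have hw : Complex.exp (θ * Complex.I) ≠ 0 := Complex.exp_ne_zero _
  have hc : ((Real.cos θ : ℝ) : ℂ) =
      (Complex.exp (θ * Complex.I) + (Complex.exp (θ * Complex.I))⁻¹) / 2 := by
    rw [← Complex.exp_neg, Complex.ofReal_cos, Complex.cos]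
    ring_nf
  induction n using Nat.twoStepInduction with
  | zero => rw [gegenbauer_zero hl, trigVal_zero, Complex.ofReal_one]
  | one => rw [gegenbauer_one hl, trigVal_one l hw, ← hc]; push_cast; ring
  | more n h0 h1 =>
    have h2 : (n : ℂ) + 2 ≠ 0 := by exact_mod_cast (show n + 2 ≠ 0 by omega)
    apply mul_left_cancel₀ h2
    rw [trigVal_rec l hw n, ← h0, ← h1, ← hc]
    exact_mod_cast gegenbauer_rec hl n (Real.cos θ)

/-- Solutions of the Gegenbauer recurrence do not vanish at nonreal points. -/
theorem rec_ne_zero_of_im_ne_zero {l : ℝ} (hl : 0 < l) {x : ℂ} (hx : x.im ≠ 0) {f : ℕ → ℂ}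
    (h0 : f 0 = 1) (h1 : f 1 = 2 * l * x)
    (hf : ∀ n : ℕ, (n + 2) * f (n + 2) = 2 * (n + 1 + l) * x * f (n + 1) - (n + 2 * l) * f n)
    (n : ℕ) : f n ≠ 0 := by
  -- Multiply the recurrence by conj f_(n+1) and take imaginary parts: (n+2) Im(f_(n+2) conj
  -- f_(n+1)) = 2(n+1+l) Im x |f_(n+1)|² + (n+2l) Im(f_(n+1) conj f_n). The sign of Im x thus
  -- propagates.
  have key : ∀ n, 0 < x.im * (f (n + 1) * (starRingEnd ℂ) (f n)).im := by
    intro n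
    induction n with
    | zero =>
      rw [zero_add, h0, h1]
      simp
      have : 0 < x.im ^ 2 := by positivity
      nlinarith
    | succ n ih =>
      have e := congrArg (fun z => (z * (starRingEnd ℂ) (f (n + 1))).im) (hf n)
      rw [show ((n : ℂ) + 2) = ((n + 2 : ℝ) : ℂ) by push_cast; ring,
        show 2 * ((n : ℂ) + 1 + l) = ((2 * (n + 1 + l) : ℝ) : ℂ) by push_cast; ring,
        show ((n : ℂ) + 2 * l) = ((n + 2 * l : ℝ) : ℂ) by push_cast; ring] at e
      simp only [Complex.mul_im, Complex.mul_re, Complex.sub_re, Complex.sub_im, Complex.conj_re,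
        Complex.conj_im, Complex.ofReal_re, Complex.ofReal_im] at e ih ⊢
      have hn : (0 : ℝ) < n + 2 := by positivity
      refine pos_of_mul_pos_right (a := (n + 2 : ℝ)) ?_ hn.le
      have p1 : 0 ≤ 2 * (n + 1 + l) * (x.im ^ 2 * ((f (n + 1)).re ^ 2 + (f (n + 1)).im ^ 2)) := by
        positivity
      have p2 : 0 < ((n : ℝ) + 2 * l) := by positivity
      have p3 := mul_pos p2 ih
      refine lt_of_lt_of_eq (add_pos_of_nonneg_of_pos p1 p3) ?_
      linear_combination -x.im * e
  intro h
  have := key n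
  rw [h] at this
  simp at this

/-- Solutions of the Gegenbauer recurrence do not vanish at real points outside `(-1, 1)`. -/
theorem rec_ne_zero_of_one_le_abs {l : ℝ} (hl : 1 ≤ l) {x : ℝ} (hx : 1 ≤ |x|) {f : ℕ → ℂ}
    (h0 : f 0 = 1) (h1 : f 1 = 2 * l * x)
    (hf : ∀ n : ℕ, (n + 2) * f (n + 2) = 2 * (n + 1 + l) * x * f (n + 1) - (n + 2 * l) * f n)
    (n : ℕ) : f n ≠ 0 := by
  obtain ⟨σ, y, hσ, hy, rfl⟩ : ∃ σ y : ℝ, σ ^ 2 = 1 ∧ 1 ≤ y ∧ x = σ * y := by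
    rcases abs_cases x with ⟨h, -⟩ | ⟨h, -⟩
    · exact ⟨1, x, by norm_num, h ▸ hx, by ring⟩
    · exact ⟨-1, -x, by norm_num, h ▸ hx, by ring⟩
  have hσ0 : σ ≠ 0 := by rintro rfl; norm_num at hσ
  -- Once the sign σ^n is removed the sequence is positive and nondecreasing, because 2(n+1+l) -
  -- (n+2l) = n + 2 and y ≥ 1.
  have key : ∀ n, ∃ a b : ℝ, 0 < a ∧ a ≤ b ∧ f n = (σ ^ n * a : ℝ) ∧
      f (n + 1) = (σ ^ (n + 1) * b : ℝ) := by
    intro n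
    induction n with
    | zero =>
      refine ⟨1, 2 * l * y, one_pos, by nlinarith, by simp [h0], ?_⟩
      rw [zero_add, h1]
      push_cast
      ring
    | succ n ih =>
      obtain ⟨a, b, ha, hab, e0, e1⟩ := ih
      have hn : (0 : ℝ) < n + 2 := by positivity
      refine ⟨b, (2 * (n + 1 + l) * y * b - (n + 2 * l) * a) / (n + 2), ha.trans_le hab, ?_, e1, ?_⟩
      · rw [le_div_iff₀ hn]
        have hb : 0 < b := ha.trans_le hab
        have hl0 : 0 < l := one_pos.trans_le hl
        have t1 : 2 * (n + 1 + l) * b * 1 ≤ 2 * (n + 1 + l) * b * y := by gcongr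
        have t2 : (n + 2 * l) * a ≤ (n + 2 * l) * b := by gcongr
        linarith
      · have h2 : (n : ℂ) + 2 ≠ 0 := by exact_mod_cast (show n + 2 ≠ 0 by omega)
        apply mul_left_cancel₀ h2
        have hσ' : (σ : ℂ) ^ 2 = 1 := by exact_mod_cast hσ
        rw [hf n, e0, e1]
        push_cast
        field_simp
        simp only [pow_succ]
        linear_combination (-σ ^ n * (n + 2 * l) * a : ℂ) * (-hσ')
  obtain ⟨a, b, ha, -, e0, -⟩ := key n
  rw [e0]
  exact_mod_cast mul_ne_zero (pow_ne_zero _ hσ0) ha.ne'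

theorem coeffD_zero_pos {l : ℝ} (hl : 0 < l) (n : ℕ) : 0 < coeffD l n (0 : ℕ) := by
  have h := coeffD_add l 0 n
  have hp := poch_pos hl n
  rw [zero_add] at h
  rw [h, poch_zero]
  positivity

theorem aeval_trigPoly_ne_zero {l : ℝ} (hl : 1 ≤ l) (n : ℕ) {z : ℂ} (hz : ‖z‖ < 1) :
    aeval z (trigPoly l n) ≠ 0 := by
  have hl0 : 0 < l := one_pos.trans_le hl
  rcases eq_or_ne z 0 with rfl | hz0
  · rw [← coeff_zero_eq_aeval_zero', coeff_trigPoly]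
    simpa using (coeffD_zero_pos hl0 n).ne'
  obtain ⟨w, rfl⟩ := IsAlgClosed.exists_pow_nat_eq z (n := 2) (by norm_num)
  have hw : w ≠ 0 := by rintro rfl; simp at hz0
  have hw1 : ‖w‖ < 1 := by
    rw [norm_pow] at hz
    exact (pow_lt_one_iff_of_nonneg (norm_nonneg _) (by norm_num)).1 hz
  suffices h : trigVal l w n ≠ 0 from right_ne_zero_of_mul h
  by_cases hx : ((w + w⁻¹) / 2).im = 0
  · have hn : Complex.normSq w < 1 := by
      rw [Complex.normSq_eq_norm_sq]
      exact (pow_lt_one_iff_of_nonneg (norm_nonneg _) (by norm_num)).2 hw1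
    have hn0 : 0 < Complex.normSq w := Complex.normSq_pos.2 hw
    -- Im(w + 1/w) = Im w · (1 - 1/|w|²), and the second factor is nonzero.
    have him : w.im = 0 := by
      have h2 : ((w + w⁻¹) / 2).im = (w.im + -w.im / Complex.normSq w) / 2 := by
        rw [show (2 : ℂ) = ((2 : ℝ) : ℂ) by simp, Complex.div_ofReal_im, Complex.add_im,
          Complex.inv_im]
      rw [h2] at hx
      field_simp at hx
      have : w.im * (Complex.normSq w - 1) = 0 := by linear_combination hx
      rcases mul_eq_zero.1 this with h | h
      · exact h
      · linarith
    obtain ⟨t, rfl⟩ : ∃ t : ℝ, w = t := ⟨w.re, Complex.ext (by simp) (by simp [him])⟩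
    have ht : t ≠ 0 := by exact_mod_cast hw
    have hx' : ((t : ℂ) + (t : ℂ)⁻¹) / 2 = (((t + t⁻¹) / 2 : ℝ) : ℂ) := by push_cast; rfl
    refine rec_ne_zero_of_one_le_abs hl (x := (t + t⁻¹) / 2) ?_ (trigVal_zero l _) ?_ ?_ n
    · have e : (t + t⁻¹) / 2 = (t ^ 2 + 1) / (2 * t) := by field_simp
      have e' : |t ^ 2 + 1| = t ^ 2 + 1 := abs_of_pos (by positivity)
      rw [e, abs_div, abs_mul, abs_two, le_div_iff₀ (by positivity), e']
      nlinarith [sq_nonneg (|t| - 1), sq_abs t]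
    · rw [trigVal_one l hw, hx']
    · intro k
      rw [trigVal_rec l hw k, hx']
  · exact rec_ne_zero_of_im_ne_zero hl0 hx (trigVal_zero l w) (trigVal_one l hw)
      (trigVal_rec l hw) n

end GegenbauerEntropy

/-! ### Szegő's terminating expansion and the weight as a cosine polynomial (λ = L + 1). -/

namespace GegenbauerEntropy

open Polynomial

theorem alpha_zero (l : ℝ) (n : ℕ) : alpha l n 0 = 1 := by simp [alpha, poch_zero]

theorem alpha_succ_right {l : ℝ} (hl : 0 < l) (n ν : ℕ) :
    alpha l n (ν + 1) =
      alpha l n ν * ((1 - l + ν) * (n + 1 + ν)) / ((ν + 1) * (n + l + 1 + ν)) := by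
  have h1 : poch (n + l + 1) ν ≠ 0 := (poch_pos (by positivity) ν).ne'
  have h2 : (n : ℝ) + l + 1 + ν ≠ 0 := by positivity
  simp only [alpha, poch_succ, Nat.factorial_succ, Nat.cast_mul, Nat.cast_add, Nat.cast_one]
  field_simp

theorem alpha_succ_left {l : ℝ} (hl : 0 < l) (n ν : ℕ) :
    alpha l (n + 1) ν =
      alpha l n ν * ((n + 1 + ν) * (n + l + 1)) / ((n + 1) * (n + l + 1 + ν)) := by
  have h1 : poch (n + l + 1) ν ≠ 0 := (poch_pos (by positivity) ν).ne'
  have h1' : poch (n + 1 + l + 1) ν ≠ 0 := (poch_pos (by positivity) ν).ne'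
  have h2 : (n : ℝ) + l + 1 + ν ≠ 0 := by positivity
  have h3 : (n : ℝ) + 1 ≠ 0 := by positivity
  have e1 : poch ((n : ℝ) + 1 + 1) ν * (n + 1) = poch (n + 1) ν * (n + 1 + ν) := by
    rw [← poch_succ, poch_succ_left, mul_comm]
  have e2 : poch ((n : ℝ) + 1 + l + 1) ν * (n + l + 1) = poch (n + l + 1) ν * (n + l + 1 + ν) := by
    rw [← poch_succ, poch_succ_left, mul_comm, show (n : ℝ) + 1 + l + 1 = n + l + 1 + 1 by ring]
  rw [alpha, alpha, Nat.cast_add, Nat.cast_one]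
  have h4 : (ν ! : ℝ) ≠ 0 := by positivity
  rw [div_mul_eq_mul_div, div_div, div_eq_div_iff (by positivity) (by positivity)]
  linear_combination poch (1 - l) ν * (ν ! : ℝ) *
    (poch (n + l + 1) ν * (n + l + 1 + ν) * e1 - poch (n + 1) ν * (n + 1 + ν) * e2)

theorem alpha_of_lt (L n : ℕ) {ν : ℕ} (h : L < ν) : alpha (L + 1 : ℕ) n ν = 0 := by
  have e : (1 : ℝ) - (L + 1 : ℕ) = -(L : ℝ) := by push_cast; ring
  rw [alpha, e, poch_neg_natCast_of_lt h]
  simp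

/-- Justifies the divisions by α_(λ-1), α_(λ-2) and α_(λ-3) in the final formula. -/
theorem alpha_ne_zero (L n : ℕ) {ν : ℕ} (h : ν ≤ L) : alpha (L + 1 : ℕ) n ν ≠ 0 := by
  induction ν with
  | zero => simp [alpha_zero]
  | succ ν ih =>
    rw [alpha_succ_right (by positivity)]
    have h1 : (1 : ℝ) - (L + 1 : ℕ) + ν ≠ 0 := by
      have : (ν : ℝ) + 1 ≤ L := by exact_mod_cast h
      push_cast
      linarith
    have := ih (by omega)
    have h2 : (n : ℝ) + 1 + ν ≠ 0 := by positivity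
    have h3 : (ν : ℝ) + 1 ≠ 0 := by positivity
    have h4 : (n : ℝ) + (L + 1 : ℕ) + 1 + ν ≠ 0 := by positivity
    positivity

/-- The normalizing factor `4 ^ L * c_n` for `lam = L + 1`. -/
noncomputable def szegoK (L n : ℕ) : ℝ := ((n + 2 * L + 1)! : ℝ) / ((L ! : ℝ) * ((n + L + 1)! : ℝ))

theorem szegoK_pos (L n : ℕ) : 0 < szegoK L n := by rw [szegoK]; positivity

theorem szegoK_succ (L n : ℕ) :
    szegoK L (n + 1) = szegoK L n * (n + 2 * L + 2) / (n + L + 2) := by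
  rw [szegoK, szegoK, show n + 1 + 2 * L + 1 = n + 2 * L + 1 + 1 by ring,
    show n + 1 + L + 1 = n + L + 1 + 1 by ring, Nat.factorial_succ (n + 2 * L + 1),
    Nat.factorial_succ (n + L + 1)]
  push_cast
  field_simp
  ring

theorem szegoC_eq (L n : ℕ) : szegoC (L + 1 : ℕ) n = szegoK L n / 4 ^ L := by
  rw [szegoC, szegoK]
  have e1 : (n : ℝ) + 2 * (L + 1 : ℕ) = (n + 2 * L + 1 : ℕ) + 1 := by push_cast; ring
  have e2 : (n : ℝ) + (L + 1 : ℕ) + 1 = (n + L + 1 : ℕ) + 1 := by push_cast; ring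
  have e3 : (2 : ℝ) ^ ((2 : ℝ) - 2 * (L + 1 : ℕ)) = (4 ^ L)⁻¹ := by
    rw [show (2 : ℝ) - 2 * (L + 1 : ℕ) = -((2 * L : ℕ) : ℝ) by push_cast; ring, Real.rpow_neg
      (by norm_num), Real.rpow_natCast, pow_mul]
    norm_num
  rw [e1, e2, e3, Real.Gamma_nat_eq_factorial, Real.Gamma_nat_eq_factorial, Nat.cast_add_one,
    Real.Gamma_nat_eq_factorial]
  field_simp

/-- The polynomial `∑ α_ν X ^ ν`. -/
noncomputable def szegoPoly (L n : ℕ) : ℝ[X] :=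
  ∑ ν ∈ Finset.range (L + 1), C (alpha (L + 1 : ℕ) n ν) * X ^ ν

theorem coeff_szegoPoly (L n ν : ℕ) : (szegoPoly L n).coeff ν = alpha (L + 1 : ℕ) n ν := by
  simp only [szegoPoly, finsetSum_coeff, coeff_C_mul, coeff_X_pow, mul_ite, mul_one, mul_zero]
  rw [Finset.sum_ite_eq, ite_eq_left_iff]
  intro h
  rw [alpha_of_lt]
  simpa [Nat.lt_succ_iff] using h

theorem natDegree_szegoPoly_le (L n : ℕ) : (szegoPoly L n).natDegree ≤ L := by
  rw [natDegree_le_iff_coeff_eq_zero]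
  intro m hm
  rw [coeff_szegoPoly, alpha_of_lt _ _ hm]

/-- This says that K_n X^(n+L+1) A_n obeys the recurrence of `trigPoly_rec`, with X^(n+L+2)
cancelled. The explicit factor `1` becomes X under reflection in degree 1. -/
theorem szegoPoly_rec (L n : ℕ) :
    C ((n + 2) * szegoK L (n + 2)) * (X * szegoPoly L (n + 2)) =
      C ((n + L + 2) * szegoK L (n + 1)) * ((1 + X) * szegoPoly L (n + 1))
        - C ((n + 2 * L + 2) * szegoK L n) * (1 * szegoPoly L n) := by
  have hl : (0 : ℝ) < (L + 1 : ℕ) := by positivity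
  ext m
  rw [coeff_sub, coeff_C_mul, coeff_C_mul, coeff_C_mul, add_mul 1 X, one_mul, one_mul, coeff_add,
    szegoK_succ L (n + 1), szegoK_succ L n]
  rcases m with _ | m
  · simp only [coeff_X_mul_zero, coeff_szegoPoly, alpha_zero]
    push_cast
    field_simp
    ring
  · simp only [coeff_X_mul, coeff_szegoPoly]
    rw [alpha_succ_left hl (n + 1), alpha_succ_right hl (n + 1), alpha_succ_left hl n,
      alpha_succ_right hl n]
    push_cast
    field_simp
    ring

/-- The first step of the recurrence has an extra constant. In Szegő's identity it cancels against
the X^(1+L) term of its reflection. -/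
theorem szegoPoly_one (L : ℕ) :
    C (szegoK L 1) * (X * szegoPoly L 1) =
      C ((L + 1) * szegoK L 0) * ((1 + X) * szegoPoly L 0)
        - C ((L + 1) * szegoK L 0) := by
  have hl : (0 : ℝ) < (L + 1 : ℕ) := by positivity
  ext m
  rw [coeff_sub, coeff_C_mul, coeff_C_mul, add_mul 1 X, one_mul, coeff_add, szegoK_succ L 0]
  rcases m with _ | m
  · simp only [coeff_X_mul_zero, coeff_szegoPoly, alpha_zero]
    simp
  · simp only [coeff_X_mul, coeff_szegoPoly, coeff_C_succ]
    rw [alpha_succ_left hl 0, alpha_succ_right hl 0]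
    push_cast
    field_simp
    ring

theorem natDegree_one_add_X_le : (1 + X : ℝ[X]).natDegree ≤ 1 := by
  compute_degree

theorem reflect_one_one_add_X : (1 + X : ℝ[X]).reflect 1 = 1 + X := by
  rw [reflect_add, reflect_one_X, reflect_one, pow_one, add_comm]

theorem reflect_szegoPoly_rec (L n : ℕ) :
    C ((n + 2) * szegoK L (n + 2)) * (szegoPoly L (n + 2)).reflect L =
      C ((n + L + 2) * szegoK L (n + 1)) * ((1 + X) * (szegoPoly L (n + 1)).reflect L)
        - C ((n + 2 * L + 2) * szegoK L n) * (X * (szegoPoly L n).reflect L) := by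
  have h := congrArg (reflect (1 + L)) (szegoPoly_rec L n)
  rw [reflect_sub, reflect_C_mul, reflect_C_mul, reflect_C_mul,
    reflect_mul _ _ natDegree_X_le (natDegree_szegoPoly_le L _),
    reflect_mul _ _ natDegree_one_add_X_le (natDegree_szegoPoly_le L _),
    reflect_mul _ _ (natDegree_one.le.trans zero_le_one) (natDegree_szegoPoly_le L _),
    reflect_one_X, reflect_one_one_add_X, reflect_one, pow_one, one_mul] at h
  exact h

theorem reflect_szegoPoly_one (L : ℕ) :
    C (szegoK L 1) * (szegoPoly L 1).reflect L =
      C ((L + 1) * szegoK L 0) * ((1 + X) * (szegoPoly L 0).reflect L)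
        - C ((L + 1) * szegoK L 0) * X ^ (1 + L) := by
  have h := congrArg (reflect (1 + L)) (szegoPoly_one L)
  rw [reflect_sub, reflect_C_mul, reflect_C_mul, reflect_C,
    reflect_mul _ _ natDegree_X_le (natDegree_szegoPoly_le L _),
    reflect_mul _ _ natDegree_one_add_X_le (natDegree_szegoPoly_le L _),
    reflect_one_X, reflect_one_one_add_X, one_mul] at h
  exact h

/-- For n = 0 these numbers are the upper half of the binomial expansion of (X - 1)^(2L+1), so
Szegő's identity starts from the binomial theorem. -/
theorem szegoK_mul_alpha_zero (L ν : ℕ) :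
    szegoK L 0 * alpha (L + 1 : ℕ) 0 ν = (-1) ^ ν * ((2 * L + 1).choose (L + 1 + ν) : ℝ) := by
  have hl : (0 : ℝ) < (L + 1 : ℕ) := by positivity
  induction ν with
  | zero =>
    rw [alpha_zero, szegoK, Nat.cast_choose ℝ (by omega)]
    simp only [show 2 * L + 1 - (L + 1 + 0) = L by omega, zero_add, add_zero]
    simp
    ring
  | succ ν ih =>
    rcases le_or_gt ν L with h | h
    · rw [alpha_succ_right hl, mul_div_assoc', ← mul_assoc, ih]
      have h1 := Nat.choose_succ_right_eq (2 * L + 1) (L + 1 + ν)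
      rw [show 2 * L + 1 - (L + 1 + ν) = L - ν by omega] at h1
      have h2 : ((2 * L + 1).choose (L + 1 + ν + 1) : ℝ) * (L + 1 + ν + 1) =
          (2 * L + 1).choose (L + 1 + ν) * (L - ν) := by
        rw [← Nat.cast_sub h]
        exact_mod_cast h1
      rw [div_eq_iff (by positivity), show L + 1 + (ν + 1) = L + 1 + ν + 1 by ring, pow_succ]
      push_cast
      linear_combination ((-1) ^ ν * (ν + 1) : ℝ) * h2
    · rw [alpha_of_lt _ _ (by omega), Nat.choose_eq_zero_of_lt (by omega)]
      simp

theorem szego_identity_zero (L : ℕ) :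
    (X - 1 : ℝ[X]) ^ (2 * L + 1) =
      C ((-1) ^ L * szegoK L 0) * (X ^ (L + 1) * szegoPoly L 0 - (szegoPoly L 0).reflect L) := by
  ext k
  rw [show (X - 1 : ℝ[X]) = X + C (-1) by simp [sub_eq_add_neg], coeff_X_add_C_pow, coeff_C_mul, coeff_sub,
    coeff_X_pow_mul', coeff_reflect, coeff_szegoPoly, coeff_szegoPoly]
  -- Degrees up to L come from the reflected polynomial only, by symmetry of the binomial row.
  -- Higher degrees come from X^(L+1) A only.
  rcases le_or_gt k L with h | h
  · rw [if_neg (by omega), revAt_le h]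
    have e := szegoK_mul_alpha_zero L (L - k)
    rw [← Nat.choose_symm (by omega), show 2 * L + 1 - (L + 1 + (L - k)) = k by omega] at e
    have e1 : (-1 : ℝ) ^ (2 * L + 1 - k) = -((-1) ^ L * (-1) ^ (L - k)) := by
      rw [show 2 * L + 1 - k = L + (L - k) + 1 by omega]
      ring
    rw [e1]
    linear_combination (-1) ^ L * e
  · rw [if_pos (by omega), revAt_eq_self_of_lt h, alpha_of_lt _ _ h, sub_zero, mul_assoc,
      szegoK_mul_alpha_zero]
    rw [show L + 1 + (k - (L + 1)) = k by omega]
    rcases le_or_gt k (2 * L + 1) with h' | h'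
    · rw [← mul_assoc, ← pow_add]
      congr 1
      rw [show L + (k - (L + 1)) = (2 * L + 1 - k) + 2 * (k - (L + 1)) by omega, pow_add, pow_mul]
      simp
    · rw [Nat.choose_eq_zero_of_lt h']
      simp

/-- Szegő's expansion of `(sin θ) ^ (2 lam - 1) * C_n(cos θ)`, as an identity of polynomials in
`exp (2 i θ)`. -/
theorem szego_identity (L n : ℕ) :
    (X - 1 : ℝ[X]) ^ (2 * L + 1) * trigPoly (L + 1 : ℕ) n =
      C ((-1) ^ L * szegoK L n) *
        (X ^ (n + L + 1) * szegoPoly L n - (szegoPoly L n).reflect L) := by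
  induction n using Nat.twoStepInduction with
  | zero => rw [trigPoly_zero, mul_one, szego_identity_zero, zero_add]
  | one =>
    have h1 := szegoPoly_one L
    have h2 := reflect_szegoPoly_one L
    rw [trigPoly_one, szego_identity_zero]
    simp only [map_mul, map_add, map_natCast, map_one, Nat.cast_add, Nat.cast_one] at h1 h2 ⊢
    linear_combination (C ((-1) ^ L)) * (h2 - X ^ (L + 1) * h1)
  | more n h0 h1 =>
    have h2 : C ((n : ℝ) + 2) ≠ 0 := by
      rw [Ne, C_eq_zero]; positivity
    apply mul_left_cancel₀ h2
    -- The sequences D_n, K_n X^(n+L+1) A_n and K_n A_n* all satisfy one recurrence.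
    have e1 := trigPoly_rec (L + 1 : ℕ) n
    have e2 := szegoPoly_rec L n
    have e3 := reflect_szegoPoly_rec L n
    simp only [map_mul, map_add, map_natCast, map_one, Nat.cast_add, Nat.cast_one, map_ofNat]
      at e1 e2 e3 h0 h1 ⊢
    linear_combination (X - 1 : ℝ[X]) ^ (2 * L + 1) * e1 + (n + 1 + (L + 1)) * (1 + X) * h1
      - (n + 2 * (L + 1)) * X * h0 + C ((-1) ^ L) * (e3 - X ^ (n + L + 2) * e2)

/-- On the unit circle conjugation is inversion, and z^N p(1/z) is the reflected polynomial. -/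
theorem conj_aeval_mul_pow {p : ℝ[X]} {N : ℕ} (hp : p.natDegree ≤ N) {z : ℂ} (hz : ‖z‖ = 1) :
    (starRingEnd ℂ) (aeval z p) * z ^ N = aeval z (p.reflect N) := by
  have hz0 : z ≠ 0 := by rintro rfl; simp at hz
  have hc : (starRingEnd ℂ) z = z⁻¹ := by
    rw [Complex.inv_def, Complex.normSq_eq_norm_sq, hz]; simp
  let _ : Invertible z⁻¹ := invertibleOfNonzero (inv_ne_zero hz0)
  have h := eval₂_reflect_mul_pow (algebraMap ℝ ℂ) z⁻¹ N p hp
  rw [invOf_eq_inv, inv_inv] at h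
  rw [← aeval_conj, hc, aeval_def, aeval_def, ← h, mul_assoc, ← mul_pow, inv_mul_cancel₀ hz0,
    one_pow, mul_one]

/-- Substituting Szegő's identity for one factor D leaves (1 - z) D A plus a second term. The
conjugation rules for D and A show that the second is the conjugate of the first. -/
theorem norm_sub_one_pow_mul_norm_trigPoly_sq (L n : ℕ) {z : ℂ} (hz : ‖z‖ = 1) :
    (‖z - 1‖ ^ 2) ^ (L + 1) * ‖aeval z (trigPoly (L + 1 : ℕ) n)‖ ^ 2 =
      2 * szegoK L n *
        (aeval z ((1 - X) * (trigPoly (L + 1 : ℕ) n * szegoPoly L n))).re := by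
  have hz0 : z ≠ 0 := by rintro rfl; simp at hz
  have hc : (starRingEnd ℂ) z = z⁻¹ := by
    rw [Complex.inv_def, Complex.normSq_eq_norm_sq, hz]; simp
  have hD := conj_aeval_mul_pow (natDegree_trigPoly_le (L + 1 : ℕ) n) hz
  have hA := conj_aeval_mul_pow (natDegree_szegoPoly_le L n) hz
  rw [reflect_trigPoly] at hD
  have hS := congrArg (aeval z) (szego_identity L n)
  simp only [map_mul, map_sub, map_pow, aeval_X, map_one, aeval_C, Complex.coe_algebraMap,
    map_neg] at hS
  simp only [map_mul, map_sub, aeval_X, map_one]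
  set D := aeval z (trigPoly (L + 1 : ℕ) n)
  set A := aeval z (szegoPoly L n)
  set B := aeval z ((szegoPoly L n).reflect L)
  apply Complex.ofReal_injective
  push_cast
  rw [← Complex.conj_mul', ← Complex.conj_mul', Complex.re_eq_add_conj]
  simp only [map_mul, map_sub, map_one, hc]
  have hD' : (starRingEnd ℂ) D = D * z⁻¹ ^ n := by
    conv_rhs => rw [← hD]
    rw [mul_assoc, ← mul_pow, mul_inv_cancel₀ hz0, one_pow, mul_one]
  have hA' : (starRingEnd ℂ) A = B * z⁻¹ ^ L := by
    rw [← hA, mul_assoc, ← mul_pow, mul_inv_cancel₀ hz0, one_pow, mul_one]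
  rw [hD', hA']
  have e : (z⁻¹ - 1) * (z - 1) = -(z - 1) ^ 2 * z⁻¹ := by field_simp; ring
  have hs : ((-1 : ℂ) ^ L) * (-1) ^ L = 1 := by rw [← mul_pow]; simp
  -- Of the 2L + 2 factors z - 1, one is set aside and the rest meet D in Szegő's identity.
  have e2 : ((z⁻¹ - 1) * (z - 1)) ^ (L + 1) * (D * z⁻¹ ^ n * D) =
      -(-1) ^ L * z⁻¹ ^ (n + L + 1) * D * (z - 1) * ((z - 1) ^ (2 * L + 1) * D) := by
    rw [e, show -(z - 1) ^ 2 * z⁻¹ = (-1) * (z - 1) ^ 2 * z⁻¹ by ring, mul_pow, mul_pow,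
      ← pow_mul]
    ring
  rw [e2, hS]
  have hzz : z⁻¹ ^ (n + L + 1) * z ^ (n + L + 1) = 1 := by
    rw [← mul_pow, inv_mul_cancel₀ hz0, one_pow]
  have e3 : (1 - z⁻¹) = (z - 1) * z⁻¹ := by field_simp
  rw [e3]
  linear_combination (-z⁻¹ ^ (n + L + 1) * D * (z - 1) * szegoK L n *
     (z ^ (n + L + 1) * A - B)) * hs - D * (z - 1) * szegoK L n * A * hzz

theorem coeff_one_sub_X_mul_trigPoly (l : ℝ) (n m : ℕ) :
    ((1 - X) * trigPoly l n).coeff m = coeffD l n m - coeffD l n ((m : ℤ) - 1) := by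
  rw [sub_mul, one_mul, coeff_sub, coeff_trigPoly]
  rcases m with _ | m
  · simp [coeffD]
  · rw [coeff_X_mul, coeff_trigPoly]
    congr 2
    push_cast
    ring

theorem coeffD_of_neg (l : ℝ) (n : ℕ) {m : ℤ} (h : m < 0) : coeffD l n m = 0 := by
  rw [coeffD, if_neg]; omega

theorem coeff_weightPoly (L n m : ℕ) :
    ((1 - X) * (trigPoly (L + 1 : ℕ) n * szegoPoly L n)).coeff m = beta (L + 1) n m := by
  have e : ((1 - X) * (trigPoly (L + 1 : ℕ) n * szegoPoly L n)).coeff m =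
      ∑ ν ∈ Finset.range (L + 1), alpha (L + 1 : ℕ) n ν *
        (coeffD (L + 1 : ℕ) n ((m : ℤ) - ν) - coeffD (L + 1 : ℕ) n ((m : ℤ) - ν - 1)) := by
    rw [← mul_assoc, mul_comm, szegoPoly, Finset.sum_mul, finsetSum_coeff]
    refine Finset.sum_congr rfl fun ν _ => ?_
    rw [mul_assoc, coeff_C_mul, coeff_X_pow_mul']
    split_ifs with h
    · rw [coeff_one_sub_X_mul_trigPoly, Nat.cast_sub h]
    · rw [coeffD_of_neg _ _ (by omega), coeffD_of_neg _ _ (by omega), sub_zero]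
  rw [e, beta]
  split_ifs with h
  -- At m = n + λ only ν = L contributes, through d_(n+1) - d_n = -d_n. The separate convention
  -- therefore agrees with the general sum.
  · subst h
    rw [Finset.sum_range_succ, Finset.sum_eq_zero]
    · have h1 : ((n + (L + 1) : ℕ) : ℤ) - L = (n + 1 : ℕ) := by push_cast; ring
      have h2 : ((n + 1 : ℕ) : ℤ) - 1 = n := by push_cast; ring
      rw [h1, h2, coeffD_of_lt _ (Nat.lt_succ_self n), Nat.add_sub_cancel]
      ring
    · intro ν hν
      rw [Finset.mem_range] at hν
      have h1 : ((n + (L + 1) : ℕ) : ℤ) - ν = (n + (L + 1) - ν : ℕ) := by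
        rw [Nat.cast_sub (by omega)]
      have h2 : ((n + (L + 1) - ν : ℕ) : ℤ) - 1 = (n + (L + 1) - ν - 1 : ℕ) := by
        rw [Nat.cast_sub (by omega : 1 ≤ n + (L + 1) - ν)]; simp
      rw [h1, h2, coeffD_of_lt _ (by omega), coeffD_of_lt _ (by omega)]
      ring
  · rfl

theorem natDegree_weightPoly_le (L n : ℕ) :
    ((1 - X) * (trigPoly (L + 1 : ℕ) n * szegoPoly L n)).natDegree ≤ n + (L + 1) := by
  have h1 : (1 - X : ℝ[X]).natDegree ≤ 1 := by compute_degree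
  have h2 := natDegree_mul_le_of_le (natDegree_trigPoly_le (L + 1 : ℕ) n)
    (natDegree_szegoPoly_le L n)
  exact (natDegree_mul_le_of_le h1 h2).trans (by omega)

end GegenbauerEntropy

/-! ### Fourier coefficients of log |p| on the unit circle. -/

namespace GegenbauerEntropy

open Polynomial MeasureTheory Filter Topology

theorem circleMap_pow (k : ℕ) (t : ℝ) :
    circleMap 0 1 t ^ k = (Real.cos (k * t) : ℂ) + Real.sin (k * t) * Complex.I := by
  rw [circleMap_zero, Complex.ofReal_one, one_mul, ← Complex.exp_nat_mul, ← mul_assoc,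
    Complex.exp_mul_I]
  push_cast
  rfl

theorem integral_cos_int_mul {j : ℤ} (hj : j ≠ 0) :
    ∫ t in (0 : ℝ)..2 * Real.pi, Real.cos (j * t) = 0 := by
  have hj' : (j : ℝ) ≠ 0 := by exact_mod_cast hj
  rw [intervalIntegral.integral_comp_mul_left Real.cos hj', integral_cos]
  have := Real.sin_int_mul_pi (j * 2)
  push_cast at this
  rw [← mul_assoc, this]
  simp

theorem integral_sin_int_mul (j : ℤ) :
    ∫ t in (0 : ℝ)..2 * Real.pi, Real.sin (j * t) = 0 := by
  rcases eq_or_ne j 0 with rfl | hj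
  · simp
  have hj' : (j : ℝ) ≠ 0 := by exact_mod_cast hj
  rw [intervalIntegral.integral_comp_mul_left Real.sin hj', integral_sin]
  rw [Real.cos_int_mul_two_pi]
  simp

theorem integral_cos_mul_cos {m k : ℕ} (hk : k ≠ 0) :
    ∫ t in (0 : ℝ)..2 * Real.pi, Real.cos (m * t) * Real.cos (k * t) =
      if k = m then Real.pi else 0 := by
  have e : ∀ t : ℝ, Real.cos (m * t) * Real.cos (k * t) =
      (Real.cos ((m + k : ℤ) * t) + Real.cos ((m - k : ℤ) * t)) / 2 := by
    intro t
    push_cast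
    rw [add_mul, sub_mul, Real.cos_add, Real.cos_sub]
    ring
  simp_rw [e]
  rw [intervalIntegral.integral_div, intervalIntegral.integral_add
    (by apply Continuous.intervalIntegrable; fun_prop)
    (by apply Continuous.intervalIntegrable; fun_prop), integral_cos_int_mul (by omega)]
  split_ifs with h
  · subst h
    simp
  · rw [integral_cos_int_mul (by omega)]
    simp

theorem integral_cos_mul_sin (m k : ℕ) :
    ∫ t in (0 : ℝ)..2 * Real.pi, Real.cos (m * t) * Real.sin (k * t) = 0 := by
  have e : ∀ t : ℝ, Real.cos (m * t) * Real.sin (k * t) =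
      (Real.sin ((m + k : ℤ) * t) - Real.sin ((m - k : ℤ) * t)) / 2 := by
    intro t
    push_cast
    rw [add_mul, sub_mul, Real.sin_add, Real.sin_sub]
    ring
  simp_rw [e]
  rw [intervalIntegral.integral_div, intervalIntegral.integral_sub
    (by apply Continuous.intervalIntegrable; fun_prop)
    (by apply Continuous.intervalIntegrable; fun_prop), integral_sin_int_mul,
    integral_sin_int_mul]
  simp

theorem integral_cos_mul_re_pow (a : ℂ) (m k : ℕ) :
    ∫ t in (0 : ℝ)..2 * Real.pi, Real.cos (m * t) * ((a * circleMap 0 1 t) ^ k / k).re =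
      if k = m then Real.pi * (a ^ m).re / m else 0 := by
  -- At k = 0 both sides are zero because division by 0 gives 0, also when m = 0.
  rcases eq_or_ne k 0 with rfl | hk
  · simp only [Nat.cast_zero, div_zero, Complex.zero_re, mul_zero, intervalIntegral.integral_zero]
    split_ifs with h
    · simp [← h]
    · rfl
  have e : ∀ t : ℝ, Real.cos (m * t) * ((a * circleMap 0 1 t) ^ k / k).re =
      (a ^ k).re / k * (Real.cos (m * t) * Real.cos (k * t)) -
      (a ^ k).im / k * (Real.cos (m * t) * Real.sin (k * t)) := by
    intro t
    rw [mul_pow, circleMap_pow, Complex.div_natCast_re]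
    simp only [Complex.mul_re, Complex.add_re, Complex.add_im, Complex.mul_im, Complex.ofReal_re,
      Complex.ofReal_im, Complex.I_re, Complex.I_im]
    ring
  simp_rw [e]
  rw [intervalIntegral.integral_sub
    (by apply Continuous.intervalIntegrable; fun_prop)
    (by apply Continuous.intervalIntegrable; fun_prop), intervalIntegral.integral_const_mul,
    intervalIntegral.integral_const_mul, integral_cos_mul_cos hk, integral_cos_mul_sin]
  split_ifs with h
  · subst h; ring
  · simp

/-- The Fourier cosine coefficients of `log ‖1 - a exp (i t)‖` for `‖a‖ < 1`. -/
theorem integral_cos_mul_log_of_norm_lt_one {a : ℂ} (ha : ‖a‖ < 1) (m : ℕ) :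
    ∫ t in (0 : ℝ)..2 * Real.pi, Real.cos (m * t) * Real.log ‖1 - a * circleMap 0 1 t‖ =
      -(Real.pi * (a ^ m).re / m) := by
  have hn : ∀ t : ℝ, ‖a * circleMap 0 1 t‖ = ‖a‖ := by simp
  have hs := summable_geometric_of_lt_one (norm_nonneg a) ha
  -- Termwise integration of the Taylor series of -log(1 - z), dominated by a geometric series.
  have h := intervalIntegral.hasSum_integral_of_dominated_convergence (μ := volume)
    (a := 0) (b := 2 * Real.pi)
    (F := fun (k : ℕ) t => Real.cos (m * t) * ((a * circleMap 0 1 t) ^ k / (k : ℂ)).re)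
    (f := fun t => -(Real.cos (m * t) * Real.log ‖1 - a * circleMap 0 1 t‖))
    (fun (k : ℕ) _ => ‖a‖ ^ k) ?_ ?_ ?_ ?_ ?_
  · simp_rw [integral_cos_mul_re_pow] at h
    have h' := h.unique (hasSum_ite_eq m (Real.pi * (a ^ m).re / m))
    rw [intervalIntegral.integral_neg] at h'
    linarith
  · intro k
    apply Continuous.aestronglyMeasurable
    fun_prop
  · refine fun k => ae_of_all _ fun t _ => ?_
    rw [norm_mul, ← one_mul (‖a‖ ^ k)]
    refine mul_le_mul (Real.abs_cos_le_one _) ?_ (norm_nonneg _) zero_le_one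
    refine (Complex.abs_re_le_norm _).trans ?_
    rw [norm_div, norm_pow, hn, Complex.norm_natCast]
    rcases k.eq_zero_or_pos with rfl | hk
    · simp
    · exact div_le_self (by positivity) (by exact_mod_cast hk)
  · exact ae_of_all _ fun _ _ => hs
  · exact intervalIntegrable_const
  · refine ae_of_all _ fun t _ => ?_
    have h1 := Complex.hasSum_re (Complex.hasSum_taylorSeries_neg_log
      (z := a * circleMap 0 1 t) (by rwa [hn]))
    rw [Complex.neg_re, Complex.log_re] at h1
    simpa using h1.mul_left (Real.cos (m * t))

/-- There are finitely many roots, each with countably many preimages. Off this null set the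
logarithm of a product splits. -/
theorem ae_eval_circleMap_ne_zero {p : ℂ[X]} (hp : p ≠ 0) :
    ∀ᵐ t : ℝ, p.eval (circleMap 0 1 t) ≠ 0 := by
  have hc : {t : ℝ | ¬ p.eval (circleMap 0 1 t) ≠ 0}.Countable := by
    have : {t : ℝ | ¬ p.eval (circleMap 0 1 t) ≠ 0} ⊆
        ⋃ ζ ∈ (p.roots.toFinset : Set ℂ), (circleMap 0 1) ⁻¹' {ζ} := by
      intro t ht
      simp only [ne_eq, not_not, Set.mem_ofPred_eq] at ht
      simp [hp, ht]
    refine Set.Countable.mono this ((Finset.countable_toSet _).biUnion fun ζ _ => ?_)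
    exact (Set.countable_singleton ζ).preimage_circleMap 0 one_ne_zero
  exact hc.ae_notMem volume |>.mono fun t ht => by simpa using ht

theorem intervalIntegrable_log_norm_eval (p : ℂ[X]) :
    IntervalIntegrable (fun t => Real.log ‖p.eval (circleMap 0 1 t)‖) volume 0 (2 * Real.pi) := by
  have : MeromorphicOn (fun z => p.eval z) (Metric.sphere 0 |1|) := by
    apply AnalyticOnNhd.meromorphicOn
    exact (AnalyticOnNhd.eval_polynomial p).mono (Set.subset_univ _)
  exact this.circleIntegrable_log_norm

theorem intervalIntegrable_cos_mul_log_norm_eval (m : ℕ) (p : ℂ[X]) :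
    IntervalIntegrable (fun t => Real.cos (m * t) * Real.log ‖p.eval (circleMap 0 1 t)‖)
      volume 0 (2 * Real.pi) :=
  (intervalIntegrable_log_norm_eval p).continuousOn_mul (by fun_prop)

/-- A bound uniform in r, for dominated convergence as r → 1. From 1 - r ≤ |1 - ru| follows |1 - u|
≤ |1 - ru| + (1 - r) ≤ 2|1 - ru|, while |1 - ru| ≤ 2. -/
theorem abs_log_norm_one_sub_mul_le {u : ℂ} (hu : ‖u‖ ≤ 1) (hu1 : 1 - u ≠ 0) {r : ℝ} (hr0 : 0 ≤ r)
    (hr : r < 1) : |Real.log ‖1 - r * u‖| ≤ |Real.log ‖1 - u‖| + Real.log 2 := by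
  have hru : ‖(r : ℂ) * u‖ ≤ r := by
    rw [norm_mul, Complex.norm_of_nonneg hr0]
    exact mul_le_of_le_one_right hr0 hu
  have h1 : 1 - r ≤ ‖1 - r * u‖ := by
    have := norm_sub_norm_le (1 : ℂ) (r * u)
    rw [norm_one] at this
    linarith
  have h2 : ‖1 - u‖ ≤ 2 * ‖1 - r * u‖ := by
    have e : 1 - u = (1 - r * u) - ((1 - r : ℝ) : ℂ) * u := by push_cast; ring
    have h3 : ‖((1 - r : ℝ) : ℂ) * u‖ ≤ 1 - r := by
      rw [norm_mul, Complex.norm_of_nonneg (by linarith)]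
      exact mul_le_of_le_one_right (by linarith) hu
    calc ‖1 - u‖ = ‖(1 - r * u) - ((1 - r : ℝ) : ℂ) * u‖ := by rw [← e]
      _ ≤ ‖1 - r * u‖ + ‖((1 - r : ℝ) : ℂ) * u‖ := norm_sub_le _ _
      _ ≤ 2 * ‖1 - r * u‖ := by linarith
  have h4 : ‖1 - r * u‖ ≤ 2 := by
    have := norm_sub_le (1 : ℂ) (r * u)
    rw [norm_one] at this
    linarith
  have hpos : 0 < ‖1 - r * u‖ := by linarith
  have hpos' : 0 < ‖1 - u‖ := norm_pos_iff.2 hu1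
  have h5 := Real.log_le_log hpos h4
  have h6 := Real.log_le_log hpos' h2
  rw [Real.log_mul (by norm_num) hpos.ne'] at h6
  have h7 := neg_abs_le (Real.log ‖1 - u‖)
  have h8 := abs_nonneg (Real.log ‖1 - u‖)
  rw [abs_le]
  constructor <;> linarith

/-- The Fourier cosine coefficients of `log ‖1 - a exp (i t)‖` for `‖a‖ ≤ 1`. -/
theorem integral_cos_mul_log_of_norm_le_one {a : ℂ} (ha : ‖a‖ ≤ 1) (m : ℕ) :
    ∫ t in (0 : ℝ)..2 * Real.pi, Real.cos (m * t) * Real.log ‖1 - a * circleMap 0 1 t‖ =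
      -(Real.pi * (a ^ m).re / m) := by
  have hp : ∀ b z : ℂ, (1 - C b * X : ℂ[X]).eval z = 1 - b * z := by simp
  have hne : (1 - C a * X : ℂ[X]) ≠ 0 := by
    intro h
    simpa using congrArg (eval 0) h
  have hae : ∀ᵐ t : ℝ, 1 - a * circleMap 0 1 t ≠ 0 := by
    simpa only [hp] using ae_eval_circleMap_ne_zero hne
  have hint : IntervalIntegrable (fun t => Real.log ‖1 - a * circleMap 0 1 t‖) volume 0
      (2 * Real.pi) := by
    have h := intervalIntegrable_log_norm_eval (1 - C a * X)
    simp only [hp] at h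
    exact h
  have hn : ∀ t : ℝ, ‖a * circleMap 0 1 t‖ ≤ 1 := by simpa using ha
  have hIoo : ∀ᶠ r : ℝ in 𝓝[<] 1, r ∈ Set.Ioo (0 : ℝ) 1 := Ioo_mem_nhdsLT one_pos
  -- Boundary case |a| = 1: apply the interior formula to ra and let r tend to 1 from below.
  have hl : Tendsto (fun r : ℝ => ∫ t in (0 : ℝ)..2 * Real.pi,
      Real.cos (m * t) * Real.log ‖1 - r * (a * circleMap 0 1 t)‖) (𝓝[<] 1)
      (𝓝 (∫ t in (0 : ℝ)..2 * Real.pi, Real.cos (m * t) *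
        Real.log ‖1 - a * circleMap 0 1 t‖)) := by
    refine intervalIntegral.tendsto_integral_filter_of_dominated_convergence
      (fun t => |Real.log ‖1 - a * circleMap 0 1 t‖| + Real.log 2) ?_ ?_ ?_ ?_
    · refine Eventually.of_forall fun r => ?_
      have h := (intervalIntegrable_iff.1
        (intervalIntegrable_cos_mul_log_norm_eval m (1 - C (r * a) * X))).aestronglyMeasurable
      simp only [hp, mul_assoc] at h
      exact h
    · filter_upwards [hIoo] with r hr
      filter_upwards [hae] with t ht _
      rw [norm_mul]
      refine (mul_le_of_le_one_left (norm_nonneg _) (Real.abs_cos_le_one _)).trans ?_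
      exact abs_log_norm_one_sub_mul_le (hn t) ht hr.1.le hr.2
    · exact hint.abs.add intervalIntegrable_const
    · filter_upwards [hae] with t ht _
      have hcont : ContinuousAt (fun r : ℝ => Real.cos (m * t) *
          Real.log ‖1 - r * (a * circleMap 0 1 t)‖) 1 := by
        refine continuousAt_const.mul (ContinuousAt.log (by fun_prop) ?_)
        simpa using ht
      have := hcont.tendsto.mono_left (nhdsWithin_le_nhds (s := Set.Iio 1))
      simpa using this
  have hr : Tendsto (fun r : ℝ => -(Real.pi * (((r : ℂ) * a) ^ m).re / m)) (𝓝[<] 1)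
      (𝓝 (-(Real.pi * (a ^ m).re / m))) := by
    have hcont : Continuous (fun r : ℝ => -(Real.pi * (((r : ℂ) * a) ^ m).re / m)) := by fun_prop
    have := (hcont.tendsto 1).mono_left (nhdsWithin_le_nhds (s := Set.Iio 1))
    simpa using this
  refine tendsto_nhds_unique hl (hr.congr' ?_)
  filter_upwards [hIoo] with r hr
  have hra : ‖(r : ℂ) * a‖ < 1 := by
    rw [norm_mul, Complex.norm_of_nonneg hr.1.le]
    exact (mul_le_of_le_one_right hr.1.le ha).trans_lt hr.2
  rw [← integral_cos_mul_log_of_norm_lt_one hra m]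
  simp only [mul_assoc]

theorem integral_cos_mul_log_norm_eval_mul {p q : ℂ[X]} (hp : p ≠ 0) (hq : q ≠ 0) (m : ℕ) :
    ∫ t in (0 : ℝ)..2 * Real.pi, Real.cos (m * t) * Real.log ‖(p * q).eval (circleMap 0 1 t)‖ =
      (∫ t in (0 : ℝ)..2 * Real.pi, Real.cos (m * t) * Real.log ‖p.eval (circleMap 0 1 t)‖) +
      ∫ t in (0 : ℝ)..2 * Real.pi, Real.cos (m * t) * Real.log ‖q.eval (circleMap 0 1 t)‖ := by
  rw [← intervalIntegral.integral_add (intervalIntegrable_cos_mul_log_norm_eval m p)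
    (intervalIntegrable_cos_mul_log_norm_eval m q)]
  refine intervalIntegral.integral_congr_ae ?_
  filter_upwards [ae_eval_circleMap_ne_zero hp, ae_eval_circleMap_ne_zero hq] with t h1 h2 _
  rw [eval_mul, norm_mul, Real.log_mul (norm_ne_zero_iff.2 h1) (norm_ne_zero_iff.2 h2), mul_add]

theorem one_sub_C_mul_X_ne_zero (a : ℂ) : (1 - C a * X : ℂ[X]) ≠ 0 := by
  intro h
  simpa using congrArg (eval 0) h

theorem prod_one_sub_C_mul_X_ne_zero (s : Multiset ℂ) :
    (s.map fun a => (1 - C a * X : ℂ[X])).prod ≠ 0 := by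
  rw [Ne, Multiset.prod_eq_zero_iff, Multiset.mem_map]
  rintro ⟨a, -, h⟩
  exact one_sub_C_mul_X_ne_zero a h

theorem integral_cos_mul_log_norm_prod (s : Multiset ℂ) (hs : ∀ a ∈ s, ‖a‖ ≤ 1) (m : ℕ) :
    ∫ t in (0 : ℝ)..2 * Real.pi, Real.cos (m * t) *
        Real.log ‖((s.map fun a => (1 - C a * X : ℂ[X])).prod).eval (circleMap 0 1 t)‖ =
      -(Real.pi * ((s.map fun a => a ^ m).sum).re / m) := by
  induction s using Multiset.induction with
  | empty => simp
  | cons a s ih =>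
    rw [Multiset.map_cons, Multiset.prod_cons, integral_cos_mul_log_norm_eval_mul
      (one_sub_C_mul_X_ne_zero a) (prod_one_sub_C_mul_X_ne_zero s),
      ih fun b hb => hs b (Multiset.mem_cons_of_mem hb)]
    have h := integral_cos_mul_log_of_norm_le_one (hs a (Multiset.mem_cons_self a s)) m
    simp only [eval_sub, eval_one, eval_mul, eval_C, eval_X, Multiset.map_cons,
      Multiset.sum_cons, Complex.add_re]
    rw [h]
    ring

/-- The logarithmic derivative of `∏ (1 - a X)` is the generating series of power sums. -/
theorem derivative_prod_one_sub_C_mul_X (s : Multiset ℂ) :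
    PowerSeries.derivative ℂ ((s.map fun a => (1 - C a * X : ℂ[X])).prod : PowerSeries ℂ) =
      ((s.map fun a => (1 - C a * X : ℂ[X])).prod : PowerSeries ℂ) *
        PowerSeries.mk fun k => -(s.map fun a => a ^ (k + 1)).sum := by
  induction s using Multiset.induction with
  | empty =>
    ext k
    simp
  | cons a s ih =>
    have h1 : PowerSeries.derivative ℂ ((1 - C a * X : ℂ[X]) : PowerSeries ℂ) =
        ((1 - C a * X : ℂ[X]) : PowerSeries ℂ) * PowerSeries.mk fun k => -a ^ (k + 1) := by
      rw [PowerSeries.derivative_coe]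
      ext k
      rcases k with _ | k
      · simp [sub_mul, mul_assoc]
      · simp [sub_mul, mul_assoc, PowerSeries.coeff_succ_X_mul]
        ring
    have h2 : (PowerSeries.mk fun k => -(((a ::ₘ s).map fun a => a ^ (k + 1)).sum)) =
        (PowerSeries.mk fun k => -a ^ (k + 1)) +
          PowerSeries.mk fun k => -(s.map fun a => a ^ (k + 1)).sum := by
      ext k
      simp
      ring
    rw [Multiset.map_cons, Multiset.prod_cons, h2, Polynomial.coe_mul, Derivation.leibniz, ih, h1]
    simp only [smul_eq_mul]
    ring

/-- The Fourier cosine coefficients of `log ‖p (exp (i t))‖` for a polynomial `p` without zeros in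
the open unit disc are, up to a factor, the coefficients of the logarithmic derivative of `p`. -/
theorem integral_cos_mul_log_norm_aeval {p : ℝ[X]} (hp : ∀ z : ℂ, ‖z‖ < 1 → aeval z p ≠ 0)
    {E : PowerSeries ℝ} (hE : PowerSeries.derivative ℝ (p : PowerSeries ℝ) = p * E) (m : ℕ) :
    ∫ t in (0 : ℝ)..2 * Real.pi, Real.cos ((m + 1 : ℕ) * t) *
      Real.log ‖aeval (circleMap 0 1 t) p‖ = Real.pi * PowerSeries.coeff m E / (m + 1 : ℕ) ∧
    ∫ t in (0 : ℝ)..2 * Real.pi, Real.log ‖aeval (circleMap 0 1 t) p‖ =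
      2 * Real.pi * Real.log |p.coeff 0| := by
  set q : ℂ[X] := p.map (algebraMap ℝ ℂ) with hq
  have hev : ∀ z : ℂ, aeval z p = q.eval z := fun z => by rw [hq, eval_map_algebraMap]
  have h0 : q.coeff 0 ≠ 0 := by
    rw [coeff_zero_eq_eval_zero, ← hev]
    exact hp 0 (by simp)
  have hq0 : q ≠ 0 := by rintro h; simp [h] at h0
  have hroot : ∀ ζ ∈ q.roots, 1 ≤ ‖ζ‖ := by
    intro ζ hζ
    by_contra! h
    exact hp ζ h (by rw [hev]; exact (mem_roots hq0).1 hζ)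
  set s : Multiset ℂ := q.roots.map fun ζ => ζ⁻¹ with hs
  have hs1 : ∀ a ∈ s, ‖a‖ ≤ 1 := by
    intro a ha
    obtain ⟨ζ, hζ, rfl⟩ := Multiset.mem_map.1 ha
    rw [norm_inv]
    exact inv_le_one_of_one_le₀ (hroot ζ hζ)
  -- Each factor X - ζ is -ζ (1 - ζ⁻¹ X), since no root is zero.
  obtain ⟨c, hc⟩ : ∃ c : ℂ, q = C c * (s.map fun a => (1 - C a * X : ℂ[X])).prod := by
    refine ⟨q.leadingCoeff * (q.roots.map fun ζ => -ζ).prod, ?_⟩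
    conv_lhs => rw [(IsAlgClosed.splits q).eq_prod_roots]
    rw [C_mul, mul_assoc, hs, Multiset.map_map, map_multiset_prod, Multiset.map_map,
      ← Multiset.prod_map_mul]
    congr 2
    refine Multiset.map_congr rfl fun ζ hζ => ?_
    have hζ0 : ζ ≠ 0 := by
      rintro rfl
      have := hroot 0 hζ
      norm_num at this
    simp only [Function.comp_apply]
    rw [mul_sub, mul_one, ← mul_assoc, ← C_mul, neg_mul, mul_inv_cancel₀ hζ0]
    simp
    ring
  set P : ℂ[X] := (s.map fun a => (1 - C a * X : ℂ[X])).prod with hP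
  have hP0 : P ≠ 0 := prod_one_sub_C_mul_X_ne_zero s
  have hPc : P.coeff 0 = 1 := by
    rw [coeff_zero_eq_eval_zero, hP, eval_multiset_prod, Multiset.map_map]
    refine Multiset.prod_eq_one fun x hx => ?_
    obtain ⟨a, -, rfl⟩ := Multiset.mem_map.1 hx
    simp
  have hcc : c = (p.coeff 0 : ℝ) := by
    have := congrArg (fun r => r.coeff 0) hc
    simp only [coeff_C_mul, hPc, mul_one] at this
    rw [← this, hq, coeff_map]
    rfl
  have hc0 : c ≠ 0 := by
    rintro rfl
    simp [hq0] at hc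
  have hlogc : Real.log ‖c‖ = Real.log |p.coeff 0| := by
    rw [hcc, Complex.norm_real, Real.norm_eq_abs]
  have hmain : ∀ k : ℕ, ∫ t in (0 : ℝ)..2 * Real.pi, Real.cos (k * t) *
      Real.log ‖aeval (circleMap 0 1 t) p‖ =
      (∫ t in (0 : ℝ)..2 * Real.pi, Real.cos (k * t) * Real.log |p.coeff 0|) +
        -(Real.pi * ((s.map fun a => a ^ k).sum).re / k) := by
    intro k
    simp_rw [hev]
    rw [hc, integral_cos_mul_log_norm_eval_mul (by simpa using hc0) hP0,
      integral_cos_mul_log_norm_prod s hs1]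
    simp only [eval_C, hlogc]
  constructor
  · rw [hmain, intervalIntegral.integral_mul_const]
    have := integral_cos_int_mul (j := ((m + 1 : ℕ) : ℤ)) (by omega)
    rw [Int.cast_natCast] at this
    rw [this]
    have hd := derivative_prod_one_sub_C_mul_X s
    rw [← hP] at hd
    have hqs : (q : PowerSeries ℂ) = PowerSeries.map (algebraMap ℝ ℂ) (p : PowerSeries ℝ) := by
      rw [hq, Polynomial.polynomial_map_coe]
    have hqE : PowerSeries.derivative ℂ (q : PowerSeries ℂ) =
        q * PowerSeries.map (algebraMap ℝ ℂ) E := by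
      rw [hqs, ← map_mul, ← hE]
      ext k
      simp [PowerSeries.coeff_derivative]
    have hqP : PowerSeries.derivative ℂ (q : PowerSeries ℂ) =
        q * PowerSeries.mk fun k => -(s.map fun a => a ^ (k + 1)).sum := by
      rw [hc, Polynomial.coe_mul, Polynomial.coe_C, Derivation.leibniz, hd]
      simp only [smul_eq_mul, PowerSeries.derivative_C]
      ring
    have hq0' : (q : PowerSeries ℂ) ≠ 0 := by simpa using hq0
    -- Both series are the logarithmic derivative of q, so the power sums of the inverse roots are
    -- minus the coefficients of E.
    have heq := mul_left_cancel₀ hq0' (hqE.symm.trans hqP)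
    have hcoeff := congrArg (fun r => (PowerSeries.coeff m r).re) heq
    simp at hcoeff
    rw [hcoeff]
    simp
    ring
  -- At frequency 0 the power-sum term is divided by 0 and vanishes, leaving the mean value of a
  -- constant.
  · have := hmain 0
    simpa using this

end GegenbauerEntropy

/-! ### Power series: multinomial coefficients and logarithmic derivatives. -/

namespace GegenbauerEntropy

open PowerSeries

theorem invFact_natCast (k : ℕ) : invFact k = 1 / (k ! : ℝ) := by simp [invFact]

theorem sum_fin_add_two {M : Type*} [AddCommMonoid M] {N : ℕ} (f : Fin (N + 2) → M) :
    ∑ j, f j = f 0 + (f 1 + ∑ i : Fin N, f i.succ.succ) := by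
  rw [Fin.sum_univ_succ, Fin.sum_univ_succ]
  rfl

theorem prod_fin_add_two {M : Type*} [CommMonoid M] {N : ℕ} (f : Fin (N + 2) → M) :
    ∏ j, f j = f 0 * (f 1 * ∏ i : Fin N, f i.succ.succ) := by
  rw [Fin.prod_univ_succ, Fin.prod_univ_succ]
  rfl

/-- The coefficients of the powers of a polynomial without constant term, by the multinomial
theorem, with the exponents of the first two terms eliminated. -/
theorem coeff_pow_sum {N : ℕ} (b : Fin (N + 2) → ℝ) (k m : ℕ) :
    coeff m ((∑ j, C (b j) * X ^ ((j : ℕ) + 1)) ^ k) =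
      ∑ κ ∈ Fintype.piFinset (fun i : Fin N => Finset.Icc 0 (m / ((i : ℕ) + 3))),
        (k ! : ℝ) * (invFact (2 * (k : ℤ) - m + ∑ i : Fin N, ((i : ℕ) + 1 : ℤ) * (κ i : ℤ))
          * invFact ((m : ℤ) - k - ∑ i : Fin N, ((i : ℕ) + 2 : ℤ) * (κ i : ℤ)))
        * (b 0 ^ (2 * (k : ℤ) - m + ∑ i : Fin N, ((i : ℕ) + 1 : ℤ) * (κ i : ℤ)).toNat
          * b 1 ^ ((m : ℤ) - k - ∑ i : Fin N, ((i : ℕ) + 2 : ℤ) * (κ i : ℤ)).toNat)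
        * ∏ i : Fin N, 1 / ((κ i)! : ℝ) * b i.succ.succ ^ κ i := by
  -- The solution (g 0, g 1) of g 0 + g 1 + ∑ κ_i = k and g 0 + 2 g 1 + ∑ (i+3) κ_i = m. Where a
  -- value is negative, `invFact` kills the term, so `toNat` is harmless.
  set z1 : (Fin N → ℕ) → ℤ := fun κ => 2 * (k : ℤ) - m + ∑ i : Fin N, ((i : ℕ) + 1 : ℤ) * (κ i : ℤ)
    with hz1
  set z2 : (Fin N → ℕ) → ℤ := fun κ => (m : ℤ) - k - ∑ i : Fin N, ((i : ℕ) + 2 : ℤ) * (κ i : ℤ)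
    with hz2
  have hsum3 : ∀ κ : Fin N → ℕ, ∑ i : Fin N, ((i : ℕ) + 3 : ℤ) * (κ i : ℤ) =
      ∑ i : Fin N, ((i : ℕ) + 1 : ℤ) * (κ i : ℤ) + 2 * ∑ i : Fin N, (κ i : ℤ) := by
    intro κ
    rw [Finset.mul_sum, ← Finset.sum_add_distrib]
    exact Finset.sum_congr rfl fun i _ => by ring
  have hsum2 : ∀ κ : Fin N → ℕ, ∑ i : Fin N, ((i : ℕ) + 2 : ℤ) * (κ i : ℤ) =
      ∑ i : Fin N, ((i : ℕ) + 1 : ℤ) * (κ i : ℤ) + ∑ i : Fin N, (κ i : ℤ) := by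
    intro κ
    rw [← Finset.sum_add_distrib]
    exact Finset.sum_congr rfl fun i _ => by ring
  have hL : coeff m ((∑ j, C (b j) * X ^ ((j : ℕ) + 1)) ^ k) =
      ∑ g ∈ (Finset.piAntidiag Finset.univ k).filter
        (fun g : Fin (N + 2) → ℕ => ∑ j : Fin (N + 2), ((j : ℕ) + 1) * g j = m),
        (Nat.multinomial Finset.univ g : ℝ) * ∏ j, b j ^ g j := by
    rw [Finset.sum_pow_eq_sum_piAntidiag, map_sum, Finset.sum_filter]
    refine Finset.sum_congr rfl fun g _ => ?_
    have e : (Nat.multinomial Finset.univ g : ℝ⟦X⟧) * ∏ j, (C (b j) * X ^ ((j : ℕ) + 1)) ^ g j =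
        C ((Nat.multinomial Finset.univ g : ℝ) * ∏ j, b j ^ g j) *
          X ^ (∑ j : Fin (N + 2), ((j : ℕ) + 1) * g j) := by
      simp only [mul_pow, ← pow_mul, Finset.prod_mul_distrib, Finset.prod_pow_eq_pow_sum, map_mul,
        map_prod, map_pow, map_natCast]
      ring
    rw [e, coeff_C_mul, coeff_X_pow]
    by_cases h : ∑ j : Fin (N + 2), ((j : ℕ) + 1) * g j = m
    · simp [h]
    · simp [h, Ne.symm h]
  have hR : ∀ κ : Fin N → ℕ, (k ! : ℝ) * (invFact (z1 κ) * invFact (z2 κ)) *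
      (b 0 ^ (z1 κ).toNat * b 1 ^ (z2 κ).toNat) *
        ∏ i : Fin N, 1 / ((κ i)! : ℝ) * b i.succ.succ ^ κ i ≠ 0 → 0 ≤ z1 κ ∧ 0 ≤ z2 κ := by
    intro κ h
    constructor
    · by_contra h'
      simp [invFact, h'] at h
    · by_contra h'
      simp [invFact, h'] at h
  rw [hL]
  change _ = ∑ κ ∈ Fintype.piFinset (fun i : Fin N => Finset.Icc 0 (m / ((i : ℕ) + 3))),
    (k ! : ℝ) * (invFact (z1 κ) * invFact (z2 κ)) *
      (b 0 ^ (z1 κ).toNat * b 1 ^ (z2 κ).toNat) *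
        ∏ i : Fin N, 1 / ((κ i)! : ℝ) * b i.succ.succ ^ κ i
  rw [← Finset.sum_filter_of_ne (p := fun κ => 0 ≤ z1 κ ∧ 0 ≤ z2 κ) fun κ _ => hR κ]
  -- the exponents of the first two terms are determined by the others
  have hg : ∀ g : Fin (N + 2) → ℕ, ∑ j, g j = k → ∑ j : Fin (N + 2), ((j : ℕ) + 1) * g j = m →
      z1 (fun i => g i.succ.succ) = g 0 ∧ z2 (fun i => g i.succ.succ) = g 1 := by
    intro g h1 h2
    rw [sum_fin_add_two] at h1 h2
    zify at h1 h2
    simp only [Fin.val_zero, Fin.val_one, Fin.val_succ, Nat.cast_add, Nat.cast_one, Nat.cast_zero]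
      at h2
    have h3 : ∑ i : Fin N, (((i : ℕ) : ℤ) + 1 + 1 + 1) * (g i.succ.succ : ℤ) =
        ∑ i : Fin N, (((i : ℕ) : ℤ) + 3) * (g i.succ.succ : ℤ) :=
      Finset.sum_congr rfl fun i _ => by ring
    rw [h3, hsum3 fun i => g i.succ.succ] at h2
    simp only [hz1, hz2]
    rw [hsum2 fun i => g i.succ.succ]
    constructor <;> linarith
  have hκ : ∀ κ : Fin N → ℕ, 0 ≤ z1 κ → 0 ≤ z2 κ →
      (∑ j, (Fin.cons (z1 κ).toNat (Fin.cons (z2 κ).toNat κ) : Fin (N + 2) → ℕ) j = k) ∧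
      ∑ j : Fin (N + 2), ((j : ℕ) + 1) *
        (Fin.cons (z1 κ).toNat (Fin.cons (z2 κ).toNat κ) : Fin (N + 2) → ℕ) j = m := by
    intro κ h1 h2
    rw [sum_fin_add_two, sum_fin_add_two]
    zify
    have e1 : (Fin.cons (z1 κ).toNat (Fin.cons (z2 κ).toNat κ) : Fin (N + 2) → ℕ) 1 =
      (z2 κ).toNat := rfl
    simp only [Fin.cons_zero, Fin.cons_succ, e1, Int.toNat_of_nonneg h1, Int.toNat_of_nonneg h2,
      Fin.val_zero, Fin.val_one, Fin.val_succ, Nat.cast_add, Nat.cast_one, Nat.cast_zero]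
    have h3 : ∑ i : Fin N, (((i : ℕ) : ℤ) + 1 + 1 + 1) * (κ i : ℤ) =
        ∑ i : Fin N, (((i : ℕ) : ℤ) + 3) * (κ i : ℤ) :=
      Finset.sum_congr rfl fun i _ => by ring
    rw [h3, hsum3]
    simp only [hz1, hz2]
    rw [hsum2]
    constructor <;> ring
  refine Finset.sum_bij' (fun g _ => fun i : Fin N => g i.succ.succ)
    (fun κ _ => Fin.cons (z1 κ).toNat (Fin.cons (z2 κ).toNat κ)) ?_ ?_ ?_ ?_ ?_
  · intro g hg'
    rw [Finset.mem_filter, Finset.mem_piAntidiag] at hg'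
    obtain ⟨e1, e2⟩ := hg g hg'.1.1 hg'.2
    rw [Finset.mem_filter, Fintype.mem_piFinset]
    refine ⟨fun i => ?_, by rw [e1]; positivity, by rw [e2]; positivity⟩
    rw [Finset.mem_Icc]
    refine ⟨Nat.zero_le _, ?_⟩
    -- The range of κ_i comes from (i+3) κ_i ≤ m, one summand of the degree equation.
    rw [Nat.le_div_iff_mul_le (by omega), mul_comm]
    have := Finset.single_le_sum (f := fun j : Fin (N + 2) => ((j : ℕ) + 1) * g j)
      (fun _ _ => Nat.zero_le _) (Finset.mem_univ i.succ.succ)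
    rw [hg'.2] at this
    simpa using this
  · intro κ hκ'
    rw [Finset.mem_filter] at hκ'
    obtain ⟨e1, e2⟩ := hκ κ hκ'.2.1 hκ'.2.2
    rw [Finset.mem_filter, Finset.mem_piAntidiag]
    exact ⟨⟨e1, by simp⟩, e2⟩
  · intro g hg'
    rw [Finset.mem_filter, Finset.mem_piAntidiag] at hg'
    obtain ⟨e1, e2⟩ := hg g hg'.1.1 hg'.2
    funext j
    refine Fin.cases ?_ (fun j => Fin.cases ?_ (fun j => ?_) j) j
    · simp [e1]
    · simp [e2]
    · simp
  · intro κ _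
    funext i
    simp
  · intro g hg'
    rw [Finset.mem_filter, Finset.mem_piAntidiag] at hg'
    obtain ⟨e1, e2⟩ := hg g hg'.1.1 hg'.2
    have hm := Nat.multinomial_spec Finset.univ g
    rw [hg'.1.1, prod_fin_add_two] at hm
    have hm' : (((g 0)! : ℝ) * ((g 1)! * ∏ i : Fin N, ((g i.succ.succ)! : ℝ))) *
        Nat.multinomial Finset.univ g = k ! := by exact_mod_cast hm
    rw [e1, e2, invFact_natCast, invFact_natCast, Int.toNat_natCast, Int.toNat_natCast, ← hm',
      prod_fin_add_two]
    have hne : (∏ i : Fin N, ((g i.succ.succ)! : ℝ)) ≠ 0 :=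
      Finset.prod_ne_zero_iff.2 fun i _ => by positivity
    rw [Finset.prod_mul_distrib, Finset.prod_div_distrib, Finset.prod_const_one]
    field_simp

/-- The coefficients of the logarithmic derivative of `1 + u`, where `X ∣ u`. -/
theorem coeff_logDeriv_one_add {u E : ℝ⟦X⟧} (hu : X ∣ u)
    (hE : PowerSeries.derivative ℝ (1 + u) = (1 + u) * E) (m : ℕ) :
    coeff m E = (m + 1 : ℝ) *
      ∑ k ∈ Finset.Icc 1 (m + 1), (-1) ^ (k + 1) / (k : ℝ) * coeff (m + 1) (u ^ k) := by
  -- The series of log(1 + u) truncated after u^(m+1). Its derivative agrees with E modulo X^(m+1).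
  set W : ℝ⟦X⟧ := ∑ k ∈ Finset.range (m + 1), C ((-1) ^ k / (k + 1 : ℝ)) * u ^ (k + 1) with hW
  have hdu : PowerSeries.derivative ℝ (1 + u) = PowerSeries.derivative ℝ u := by
    rw [map_add, derivative_one, zero_add]
  have hdW : PowerSeries.derivative ℝ W =
      (∑ k ∈ Finset.range (m + 1), (-u) ^ k) * PowerSeries.derivative ℝ u := by
    rw [hW, map_sum, Finset.sum_mul]
    refine Finset.sum_congr rfl fun k _ => ?_
    rw [Derivation.leibniz, derivative_C, derivative_pow]
    simp only [smul_eq_mul, Nat.add_sub_cancel, mul_zero, add_zero]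
    have e : (C ((-1) ^ k / ((k : ℝ) + 1)) : ℝ⟦X⟧) * ((k + 1 : ℕ) : ℝ⟦X⟧) = (-1) ^ k := by
      rw [← map_natCast (C (R := ℝ)), ← map_mul]
      push_cast
      rw [div_mul_cancel₀ _ (by positivity)]
      simp
    rw [← mul_assoc, ← mul_assoc, e, neg_pow u]
  have hgeom : (1 + u) * ∑ k ∈ Finset.range (m + 1), (-u) ^ k = 1 - (-u) ^ (m + 1) := by
    have := mul_neg_geom_sum (-u) (m + 1)
    rwa [sub_neg_eq_add] at this
  have hdiff : (1 + u) * (E - PowerSeries.derivative ℝ W) =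
      (-u) ^ (m + 1) * PowerSeries.derivative ℝ u := by
    rw [mul_sub, ← hE, hdW, ← mul_assoc, hgeom, hdu]
    ring
  have hunit : IsUnit (1 + u) := by
    rw [isUnit_iff_constantCoeff, map_add, map_one, X_dvd_iff.1 hu]
    simp
  have hdvd : X ^ (m + 1) ∣ E - PowerSeries.derivative ℝ W := by
    rw [← hunit.dvd_mul_left, hdiff]
    exact Dvd.dvd.mul_right (pow_dvd_pow_of_dvd ((dvd_neg).2 hu) _) _
  have h0 := X_pow_dvd_iff.1 hdvd m (Nat.lt_succ_self m)
  rw [map_sub, sub_eq_zero] at h0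
  rw [h0, coeff_derivative, hW, map_sum, mul_comm]
  congr 1
  rw [← Finset.Ico_add_one_right_eq_Icc, Finset.sum_Ico_eq_sum_range]
  refine Finset.sum_congr (by simp) fun k _ => ?_
  rw [coeff_C_mul, add_comm 1 k]
  push_cast
  ring

/-- Adding a term `-γ X ^ (M + 1) g` to a power series `f` with constant coefficient `1` changes
the coefficients of its logarithmic derivative up to degree `M` only in degree `M`. -/
theorem coeff_logDeriv_sub_C_mul_X_pow_mul {f g E F : ℝ⟦X⟧} {γ : ℝ} {M : ℕ}
    (hf : constantCoeff f = 1) (hg : constantCoeff g = 1)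
    (hE : PowerSeries.derivative ℝ f = f * E)
    (hF : PowerSeries.derivative ℝ (f - C γ * X ^ (M + 1) * g) =
      (f - C γ * X ^ (M + 1) * g) * F) {m : ℕ} (hm : m ≤ M) :
    coeff m F = coeff m E - if m = M then γ * (M + 1) else 0 := by
  set R := f - C γ * X ^ (M + 1) * g with hR
  have hunit : IsUnit R := by
    rw [isUnit_iff_constantCoeff, hR, map_sub, hf]
    simp
  have hdR : PowerSeries.derivative ℝ R =
      f * E - C γ * X ^ (M + 1) * PowerSeries.derivative ℝ g - C (γ * (M + 1)) * X ^ M * g := by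
    rw [hR, map_sub, hE, Derivation.leibniz, Derivation.leibniz, derivative_C, derivative_pow,
      derivative_X]
    simp
    ring
  -- In the term of degree M the series g may be traded for the perturbed one, since they agree
  -- modulo X.
  obtain ⟨v, hv⟩ : X ∣ f - g := by rw [X_dvd_iff, map_sub, hf, hg, sub_self]
  have hdvd : X ^ (M + 1) ∣ F - E + C (γ * (M + 1)) * X ^ M := by
    rw [← hunit.dvd_mul_left]
    refine ⟨C γ * g * E - C γ * PowerSeries.derivative ℝ g + C (γ * (M + 1)) * v
      - C γ * g * C (γ * (M + 1)) * X ^ M, ?_⟩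
    have h1 := hF.symm.trans hdR
    rw [mul_add, mul_sub, h1, hR]
    linear_combination C (γ * (M + 1)) * X ^ M * hv
  have h0 := X_pow_dvd_iff.1 hdvd m (by omega)
  rw [map_add, map_sub, coeff_C_mul, coeff_X_pow] at h0
  split_ifs at h0 ⊢ <;> linarith

theorem derivative_one_sub_X_pow (K : ℕ) :
    PowerSeries.derivative ℝ ((1 - X : ℝ⟦X⟧) ^ K) =
      (1 - X) ^ K * (-(K : ℝ⟦X⟧) * mk fun _ => 1) := by
  rcases K with _ | K
  · simp
  · have h := mk_one_mul_one_sub_eq_one ℝ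
    rw [derivative_pow, map_sub, derivative_one, derivative_X, Nat.add_sub_cancel]
    linear_combination (((K + 1 : ℕ) : ℝ⟦X⟧) * (1 - X) ^ K) * h

end GegenbauerEntropy

/-! ### The multiple sum and the logarithmic derivative of D (λ = N + 3). -/

namespace GegenbauerEntropy

open PowerSeries

/-- The multiple sum that gives minus the coefficient of `X ^ m` in the logarithm of
`∑ (α_{lam-1-j} / α_{lam-1}) X ^ j` for `lam = N + 3`. -/
noncomputable def waringSum (N n m : ℕ) : ℝ :=
  ∑ k ∈ Finset.Icc 1 m,
    ∑ κ ∈ Fintype.piFinset (fun i : Fin N => Finset.Icc 0 (m / ((i : ℕ) + 3))),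
      (alpha (N + 3 : ℕ) n N / alpha (N + 3 : ℕ) n (N + 1)) ^ m
      * (-(alpha (N + 3 : ℕ) n (N + 1) ^ 2
          / (alpha (N + 3 : ℕ) n (N + 2) * alpha (N + 3 : ℕ) n N))) ^ k
      * ((((k - 1)! : ℕ) : ℝ)
          * invFact (2 * (k : ℤ) - m + ∑ i : Fin N, ((i : ℕ) + 1 : ℤ) * (κ i : ℤ))
          * invFact ((m : ℤ) - k - ∑ i : Fin N, ((i : ℕ) + 2 : ℤ) * (κ i : ℤ)))
      * ∏ i : Fin N, 1 / ((κ i)! : ℝ)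
          * (alpha (N + 3 : ℕ) n (N + 2 - ((i : ℕ) + 3))
              * alpha (N + 3 : ℕ) n (N + 1) ^ ((i : ℕ) + 1)
              / alpha (N + 3 : ℕ) n N ^ ((i : ℕ) + 2)) ^ κ i

/-- Here p, q, r stand for α_(λ-1), α_(λ-2), α_(λ-3). The left side is the form in the theorem, the
right side the multinomial term. With S₀ = ∑ κ_i and S₁ = ∑ (i+1) κ_i, the relations k = e + f + S₀
and m = e + 2f + 2S₀ + S₁ match all exponents. -/
theorem waring_monomial_eq {N : ℕ} {p q r : ℝ} (hp : p ≠ 0) (hq : q ≠ 0) (hr : r ≠ 0)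
    (x : Fin N → ℝ) (κ : Fin N → ℕ) {k m e f : ℕ}
    (he : (e : ℤ) = 2 * (k : ℤ) - m + ∑ i : Fin N, ((i : ℕ) + 1 : ℤ) * (κ i : ℤ))
    (hf : (f : ℤ) = (m : ℤ) - k - ∑ i : Fin N, ((i : ℕ) + 2 : ℤ) * (κ i : ℤ)) :
    (r / q) ^ m * (q ^ 2 / (p * r)) ^ k *
        ∏ i : Fin N, (x i * q ^ ((i : ℕ) + 1) / r ^ ((i : ℕ) + 2)) ^ κ i =
      (q / p) ^ e * (r / p) ^ f * ∏ i : Fin N, (x i / p) ^ κ i := by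
  set S₀ := ∑ i : Fin N, κ i with hS₀
  set S₁ := ∑ i : Fin N, ((i : ℕ) + 1) * κ i with hS₁
  have h2 : ∑ i : Fin N, ((i : ℕ) + 2) * κ i = S₁ + S₀ := by
    rw [hS₀, hS₁, ← Finset.sum_add_distrib]
    exact Finset.sum_congr rfl fun i _ => by ring
  have he' : (e : ℤ) = 2 * (k : ℤ) - m + S₁ := by rw [he, hS₁]; push_cast; rfl
  have hf' : (f : ℤ) = (m : ℤ) - k - (S₁ + S₀ : ℕ) := by rw [hf, ← h2]; push_cast; rfl
  obtain rfl : k = e + f + S₀ := by omega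
  obtain rfl : m = e + 2 * f + 2 * S₀ + S₁ := by omega
  have e1 : ∏ i : Fin N, (x i * q ^ ((i : ℕ) + 1) / r ^ ((i : ℕ) + 2)) ^ κ i =
      (∏ i : Fin N, x i ^ κ i) * q ^ S₁ / r ^ (S₁ + S₀) := by
    simp only [div_pow, mul_pow, ← pow_mul, Finset.prod_div_distrib, Finset.prod_mul_distrib,
      Finset.prod_pow_eq_pow_sum, h2]
    rw [← hS₁]
  have e2 : ∏ i : Fin N, (x i / p) ^ κ i = (∏ i : Fin N, x i ^ κ i) / p ^ S₀ := by
    simp only [div_pow, Finset.prod_div_distrib, Finset.prod_pow_eq_pow_sum]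
    rw [← hS₀]
  rw [e1, e2]
  generalize (∏ i : Fin N, x i ^ κ i) = P
  simp only [div_pow]
  field_simp
  ring

/-- The polynomial `∑_{j ≥ 1} (α_{lam-1-j} / α_{lam-1}) X ^ j` for `lam = N + 3`. -/
noncomputable def reversedTail (N n : ℕ) : ℝ⟦X⟧ :=
  ∑ j : Fin (N + 2), C (alpha (N + 3 : ℕ) n (N + 1 - j) / alpha (N + 3 : ℕ) n (N + 2)) *
    X ^ ((j : ℕ) + 1)

theorem X_dvd_reversedTail (N n : ℕ) : X ∣ reversedTail N n :=
  Finset.dvd_sum fun _ _ => (dvd_pow_self X (Nat.succ_ne_zero _)).mul_left _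

theorem coeff_logDeriv_reversedTail (N n : ℕ) {E : ℝ⟦X⟧}
    (hE : PowerSeries.derivative ℝ (1 + reversedTail N n) = (1 + reversedTail N n) * E) (m : ℕ) :
    coeff m E = -((m + 1 : ℝ) * waringSum N n (m + 1)) := by
  have hp : alpha (N + 3 : ℕ) n (N + 2) ≠ 0 := alpha_ne_zero (N + 2) n le_rfl
  have hq : alpha (N + 3 : ℕ) n (N + 1) ≠ 0 := alpha_ne_zero (N + 2) n (by omega)
  have hr : alpha (N + 3 : ℕ) n N ≠ 0 := alpha_ne_zero (N + 2) n (by omega)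
  rw [coeff_logDeriv_one_add (X_dvd_reversedTail N n) hE m, ← mul_neg, waringSum,
    ← Finset.sum_neg_distrib]
  congr 1
  refine Finset.sum_congr rfl fun k hk => ?_
  have hk1 : 1 ≤ k := (Finset.mem_Icc.1 hk).1
  rw [reversedTail, coeff_pow_sum (fun j : Fin (N + 2) => alpha (N + 3 : ℕ) n (N + 1 - j) /
    alpha (N + 3 : ℕ) n (N + 2)), Finset.mul_sum, ← Finset.sum_neg_distrib]
  refine Finset.sum_congr rfl fun κ _ => ?_
  set z1 : ℤ := 2 * (k : ℤ) - (m + 1 : ℕ) + ∑ i : Fin N, ((i : ℕ) + 1 : ℤ) * (κ i : ℤ) with hz1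
  set z2 : ℤ := ((m + 1 : ℕ) : ℤ) - k - ∑ i : Fin N, ((i : ℕ) + 2 : ℤ) * (κ i : ℤ) with hz2
  by_cases h1 : 0 ≤ z1
  swap
  · simp [invFact, h1]
  by_cases h2 : 0 ≤ z2
  swap
  · simp [invFact, h2]
  have key := waring_monomial_eq hp hq hr
    (fun i : Fin N => alpha (N + 3 : ℕ) n (N + 2 - ((i : ℕ) + 3))) κ
    (k := k) (m := m + 1) (e := z1.toNat) (f := z2.toNat)
    (by rw [Int.toNat_of_nonneg h1]) (by rw [Int.toNat_of_nonneg h2])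
  have hidx : ∀ i : Fin N, N + 1 - ((i.succ.succ : Fin (N + 2)) : ℕ) = N + 2 - ((i : ℕ) + 3) := by
    intro i
    simp only [Fin.val_succ]
    omega
  have hfac : (k ! : ℝ) = k * ((k - 1)! : ℕ) := by
    rw [← Nat.mul_factorial_pred (by omega : k ≠ 0)]
    push_cast
    rfl
  simp only [hidx, Fin.val_zero, Fin.val_one, Nat.sub_zero, Nat.add_sub_cancel,
    Finset.prod_mul_distrib] at key ⊢
  -- The sign (-1)^k sits in the base of the k-th power, and k!/k gives (k-1)!.
  rw [neg_pow, hfac, pow_succ]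
  have hk0 : (k : ℝ) ≠ 0 := by positivity
  generalize (∏ i : Fin N, 1 / ((κ i)! : ℝ)) = Q
  have hcancel : (-1 : ℝ) ^ k * -1 / k * (k * ((k - 1)! : ℕ)) = -((-1) ^ k * ((k - 1)! : ℕ)) := by
    field_simp
  generalize (∏ i : Fin N, (alpha (N + 3 : ℕ) n (N + 2 - ((i : ℕ) + 3)) /
    alpha (N + 3 : ℕ) n (N + 2)) ^ κ i) = Q' at *
  linear_combination ((-1) ^ k * ((k - 1)! : ℕ) * invFact z1 * invFact z2 * Q) * key
    + (invFact z1 * invFact z2 * Q *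
      (alpha (N + 3 : ℕ) n (N + 1) / alpha (N + 3 : ℕ) n (N + 2)) ^ z1.toNat *
      (alpha (N + 3 : ℕ) n N / alpha (N + 3 : ℕ) n (N + 2)) ^ z2.toNat * Q') * hcancel

/-- Normalizes A* to constant coefficient 1, as the expansion of the logarithm requires. -/
theorem coe_reflect_szegoPoly (N n : ℕ) :
    ((szegoPoly (N + 2) n).reflect (N + 2) : ℝ⟦X⟧) =
      C (alpha (N + 3 : ℕ) n (N + 2)) * (1 + reversedTail N n) := by
  have hp : alpha (N + 3 : ℕ) n (N + 2) ≠ 0 := alpha_ne_zero (N + 2) n le_rfl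
  have hsum : reversedTail N n = ∑ j ∈ Finset.range (N + 2),
      C (alpha (N + 3 : ℕ) n (N + 1 - j) / alpha (N + 3 : ℕ) n (N + 2)) * X ^ (j + 1) :=
    Fin.sum_univ_eq_sum_range (fun j => C (alpha (N + 3 : ℕ) n (N + 1 - j) /
      alpha (N + 3 : ℕ) n (N + 2)) * (X : ℝ⟦X⟧) ^ (j + 1)) (N + 2)
  ext i
  rw [Polynomial.coeff_coe, Polynomial.coeff_reflect, coeff_szegoPoly, coeff_C_mul, map_add, hsum,
    map_sum]
  simp only [coeff_C_mul, coeff_X_pow, mul_ite, mul_one, mul_zero]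
  rcases i with _ | i
  · simp
    norm_num [add_assoc]
  · simp only [Nat.add_right_cancel_iff, Finset.sum_ite_eq, Finset.mem_range, coeff_one,
      Nat.succ_ne_zero, if_false, zero_add]
    split_ifs with h
    · rw [Polynomial.revAt_le (by omega), mul_div_cancel₀ _ hp]
      congr 1
      omega
    · rw [Polynomial.revAt_eq_self_of_lt (by omega), mul_zero]
      exact alpha_of_lt (N + 2) n (by omega)

/-- The coefficients of the logarithmic derivative of `∑ d_m X ^ m` up to degree `n + lam - 1`. -/
theorem coeff_logDeriv_trigPoly (N n : ℕ) {E : ℝ⟦X⟧}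
    (hE : PowerSeries.derivative ℝ (trigPoly (N + 3 : ℕ) n : ℝ⟦X⟧) =
      (trigPoly (N + 3 : ℕ) n : ℝ⟦X⟧) * E) {m : ℕ} (hm : m ≤ n + N + 2) :
    coeff m E = 2 * (N + 3 : ℕ) - 1 - (m + 1 : ℝ) * waringSum N n (m + 1)
      - if m = n + N + 2 then (m + 1 : ℝ) / alpha (N + 3 : ℕ) n (N + 2) else 0 := by
  have hp : alpha (N + 3 : ℕ) n (N + 2) ≠ 0 := alpha_ne_zero (N + 2) n le_rfl
  set a := alpha (N + 3 : ℕ) n (N + 2) with ha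
  have hf : constantCoeff (1 + reversedTail N n) = 1 := by
    rw [map_add, map_one, X_dvd_iff.1 (X_dvd_reversedTail N n), add_zero]
  have hg : constantCoeff (szegoPoly (N + 2) n : ℝ⟦X⟧) = 1 := by
    rw [← coeff_zero_eq_constantCoeff_apply, Polynomial.coeff_coe, coeff_szegoPoly, alpha_zero]
  set EB := PowerSeries.derivative ℝ (1 + reversedTail N n) * (1 + reversedTail N n)⁻¹ with hEB
  have hEB' : PowerSeries.derivative ℝ (1 + reversedTail N n) = (1 + reversedTail N n) * EB := by
    rw [hEB, mul_left_comm, PowerSeries.mul_inv_cancel _ (by rw [hf]; exact one_ne_zero), mul_one]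
  set c : ℝ := (-1) ^ (N + 2) * szegoK (N + 2) n * a with hc
  -- Szegő's identity divided by its constant, with 1/α_(λ-1) left in front of X^(n+λ) A.
  have hS : (1 + reversedTail N n) - C (1 / a) * X ^ (n + N + 2 + 1) * (szegoPoly (N + 2) n : ℝ⟦X⟧)
      = C c⁻¹ * ((1 - X) ^ (2 * (N + 2) + 1) * (trigPoly (N + 3 : ℕ) n : ℝ⟦X⟧)) := by
    have h := congrArg (fun p : Polynomial ℝ => (p : ℝ⟦X⟧)) (szego_identity (N + 2) n)
    simp only [Polynomial.coe_mul, Polynomial.coe_pow, Polynomial.coe_sub, Polynomial.coe_X,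
      Polynomial.coe_one, Polynomial.coe_C, coe_reflect_szegoPoly] at h
    have hodd : (X - 1 : ℝ⟦X⟧) ^ (2 * (N + 2) + 1) = -(1 - X) ^ (2 * (N + 2) + 1) := by
      rw [← neg_sub, Odd.neg_pow ⟨N + 2, rfl⟩]
    rw [hodd, ← ha] at h
    have hca : (C c⁻¹ : ℝ⟦X⟧) * C ((-1) ^ (N + 2) * szegoK (N + 2) n) = C (1 / a) := by
      rw [← map_mul, hc]
      congr 1
      have := (szegoK_pos (N + 2) n).ne'
      have h1 : (-1 : ℝ) ^ (N + 2) ≠ 0 := by simp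
      field_simp
    have haa : (C (1 / a) : ℝ⟦X⟧) * C a = 1 := by
      rw [← map_mul, one_div, inv_mul_cancel₀ hp, map_one]
    have h' := congrArg (fun p => C c⁻¹ * p) h
    simp only [← mul_assoc, hca] at h'
    linear_combination (-(1 + reversedTail N n)) * haa + h'
  -- The factor (1 - X)^(2λ-1) adds -(2λ-1)/(1 - X) to the logarithmic derivative of D.
  have hF : PowerSeries.derivative ℝ ((1 + reversedTail N n) -
      C (1 / a) * X ^ (n + N + 2 + 1) * (szegoPoly (N + 2) n : ℝ⟦X⟧)) =
      ((1 + reversedTail N n) - C (1 / a) * X ^ (n + N + 2 + 1) * (szegoPoly (N + 2) n : ℝ⟦X⟧)) *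
        (E - ((2 * (N + 2) + 1 : ℕ) : ℝ⟦X⟧) * mk fun _ => 1) := by
    rw [hS, Derivation.leibniz, Derivation.leibniz, derivative_C, hE, derivative_one_sub_X_pow]
    simp only [smul_eq_mul]
    ring
  have hcoeff := coeff_logDeriv_sub_C_mul_X_pow_mul hf hg hEB' hF hm
  rw [coeff_logDeriv_reversedTail N n hEB' m, map_sub, ← map_natCast (C (R := ℝ)), coeff_C_mul,
    coeff_mk] at hcoeff
  push_cast at hcoeff ⊢
  split_ifs at hcoeff ⊢ with h
  · subst h
    push_cast at hcoeff ⊢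
    linear_combination hcoeff
  · linear_combination hcoeff

end GegenbauerEntropy

/-! ### The entropy integral and the final formula. -/

namespace GegenbauerEntropy

open MeasureTheory Polynomial

/-- The function y log y is continuous at 0, so convergence of the entropy integral is immediate. -/
theorem continuous_entropyIntegrand {l : ℝ} (hl : 1 ≤ l) (n : ℕ) :
    Continuous (entropyIntegrand l n) := by
  have h1 : Continuous fun x => gegenbauer l n x ^ 2 :=
    (continuous_gegenbauer (by linarith) n).pow 2
  have h2 : Continuous fun x : ℝ => (1 - x ^ 2) ^ (l - 1 / 2) :=
    Continuous.rpow_const (by fun_prop) fun _ => Or.inr (by linarith)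
  exact (Real.continuous_mul_log.comp h1).mul h2

theorem integral_entropyIntegrand_eq_integral_cos {l : ℝ} (hl : 1 ≤ l) (n : ℕ) :
    ∫ x in (-1 : ℝ)..1, entropyIntegrand l n x =
      ∫ θ in (0 : ℝ)..Real.pi, entropyIntegrand l n (Real.cos θ) * Real.sin θ := by
  have h := intervalIntegral.integral_comp_mul_deriv (a := 0) (b := Real.pi) (f := Real.cos)
    (f' := fun θ => -Real.sin θ) (g := entropyIntegrand l n)
    (fun θ _ => Real.hasDerivAt_cos θ) (by fun_prop) (continuous_entropyIntegrand hl n)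
  rw [Real.cos_zero, Real.cos_pi, intervalIntegral.integral_symm (-1) 1] at h
  rw [← neg_inj, ← h, ← intervalIntegral.integral_neg]
  simp

theorem gegenbauer_cos_sq {l : ℝ} (hl : 0 < l) (n : ℕ) (θ : ℝ) :
    gegenbauer l n (Real.cos θ) ^ 2 = ‖aeval (circleMap 0 1 (2 * θ)) (trigPoly l n)‖ ^ 2 := by
  have h := congrArg norm (gegenbauer_cos hl θ n)
  have hw : Complex.exp (θ * Complex.I) ^ 2 = circleMap 0 1 (2 * θ) := by
    rw [circleMap_zero, ← Complex.exp_nat_mul]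
    push_cast
    ring_nf
  rw [trigVal, hw, norm_mul, norm_pow, norm_inv, Complex.norm_exp_ofReal_mul_I, inv_one, one_pow,
    one_mul, Complex.norm_real] at h
  rw [← h, Real.norm_eq_abs, sq_abs]

theorem norm_circleMap_sub_one_sq (θ : ℝ) :
    ‖circleMap 0 1 (2 * θ) - 1‖ ^ 2 = 4 * Real.sin θ ^ 2 := by
  have h := circleMap_pow 1 (2 * θ)
  rw [pow_one, Nat.cast_one, one_mul] at h
  rw [h, ← Complex.normSq_eq_norm_sq, Complex.normSq_apply]
  simp only [Complex.sub_re, Complex.add_re, Complex.ofReal_re, Complex.mul_re, Complex.ofReal_im,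
    Complex.I_re, Complex.I_im, Complex.one_re, Complex.sub_im, Complex.add_im, Complex.mul_im,
    Complex.one_im]
  rw [Real.cos_two_mul, Real.sin_two_mul]
  have := Real.sin_sq_add_cos_sq θ
  have e : Real.sin θ ^ 2 = 1 - Real.cos θ ^ 2 := by linarith
  ring_nf
  rw [e]
  ring

theorem re_aeval_circleMap {p : ℝ[X]} {N : ℕ} (hp : p.natDegree ≤ N) (t : ℝ) :
    (aeval (circleMap 0 1 t) p).re = ∑ m ∈ Finset.range (N + 1), p.coeff m * Real.cos (m * t) := by
  rw [aeval_eq_sum_range' (Nat.lt_succ_of_le hp), Complex.re_sum]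
  refine Finset.sum_congr rfl fun m _ => ?_
  rw [Complex.smul_re, circleMap_pow, Complex.add_re, Complex.re_ofReal_mul, Complex.ofReal_re,
    Complex.I_re, mul_zero, add_zero, smul_eq_mul]

/-- The weight sin^(2λ-1) and the Jacobian sin θ combine to sin^(2λ) θ = |z - 1|^(2λ)/4^λ. The 2
from log |D|² and the 2 in the weight identity turn 4^(-λ) into the 4^(-L) of c_n. -/
theorem entropyIntegrand_cos_mul_sin (L n : ℕ) {θ : ℝ} (hθ : 0 ≤ Real.sin θ) :
    entropyIntegrand (L + 1 : ℕ) n (Real.cos θ) * Real.sin θ =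
      szegoC (L + 1 : ℕ) n * ((aeval (circleMap 0 1 (2 * θ))
        ((1 - X) * (trigPoly (L + 1 : ℕ) n * szegoPoly L n))).re *
          Real.log ‖aeval (circleMap 0 1 (2 * θ)) (trigPoly (L + 1 : ℕ) n)‖) := by
  have hl : (0 : ℝ) < (L + 1 : ℕ) := by positivity
  have hz : ‖circleMap 0 1 (2 * θ)‖ = 1 := by simp
  have hw := norm_sub_one_pow_mul_norm_trigPoly_sq L n hz
  rw [norm_circleMap_sub_one_sq] at hw
  have hs : (1 - Real.cos θ ^ 2) ^ (((L + 1 : ℕ) : ℝ) - 1 / 2) = Real.sin θ ^ (2 * L + 1) := by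
    rw [← Real.sin_sq, ← Real.rpow_natCast (Real.sin θ) 2, ← Real.rpow_mul hθ,
      ← Real.rpow_natCast (Real.sin θ) (2 * L + 1)]
    congr 1
    push_cast
    ring
  rw [entropyIntegrand, gegenbauer_cos_sq hl, hs, Real.log_pow, szegoC_eq]
  set D := ‖aeval (circleMap 0 1 (2 * θ)) (trigPoly (L + 1 : ℕ) n)‖
  rw [mul_pow, ← pow_mul] at hw
  have e : Real.sin θ ^ (2 * (L + 1)) = Real.sin θ ^ (2 * L + 1) * Real.sin θ := by ring
  rw [e, pow_succ 4 L] at hw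
  push_cast
  rw [div_mul_eq_mul_div, eq_div_iff (by positivity)]
  push_cast at hw
  linear_combination (Real.log D / 2) * hw

/-- The substitution t = 2θ gives the full circle and the factor 1/2. -/
theorem entropy_eq_sum (L n : ℕ) :
    entropy (L + 1 : ℕ) n = -(szegoC (L + 1 : ℕ) n / 2) *
      ∑ m ∈ Finset.range (n + (L + 1) + 1), beta (L + 1) n m *
        ∫ t in (0 : ℝ)..2 * Real.pi, Real.cos (m * t) *
          Real.log ‖aeval (circleMap 0 1 t) (trigPoly (L + 1 : ℕ) n)‖ := by
  have hl : (1 : ℝ) ≤ (L + 1 : ℕ) := by exact_mod_cast Nat.le_add_left 1 L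
  have hint : ∀ m : ℕ, IntervalIntegrable (fun t => Real.cos (m * t) *
      Real.log ‖aeval (circleMap 0 1 t) (trigPoly (L + 1 : ℕ) n)‖) volume 0 (2 * Real.pi) := by
    intro m
    have := intervalIntegrable_cos_mul_log_norm_eval m
      ((trigPoly (L + 1 : ℕ) n).map (algebraMap ℝ ℂ))
    simpa only [eval_map_algebraMap] using this
  set h : ℝ → ℝ := fun t => szegoC (L + 1 : ℕ) n * ((aeval (circleMap 0 1 t)
        ((1 - X) * (trigPoly (L + 1 : ℕ) n * szegoPoly L n))).re *
          Real.log ‖aeval (circleMap 0 1 t) (trigPoly (L + 1 : ℕ) n)‖) with hh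
  have e1 : ∫ θ in (0 : ℝ)..Real.pi, entropyIntegrand (L + 1 : ℕ) n (Real.cos θ) * Real.sin θ =
      ∫ θ in (0 : ℝ)..Real.pi, h (2 * θ) := by
    refine intervalIntegral.integral_congr fun θ hθ => ?_
    rw [Set.uIcc_of_le Real.pi_pos.le] at hθ
    exact entropyIntegrand_cos_mul_sin L n (Real.sin_nonneg_of_nonneg_of_le_pi hθ.1 hθ.2)
  have e2 : ∫ t in (0 : ℝ)..2 * Real.pi, h t = szegoC (L + 1 : ℕ) n *
      ∑ m ∈ Finset.range (n + (L + 1) + 1), beta (L + 1) n m *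
        ∫ t in (0 : ℝ)..2 * Real.pi, Real.cos (m * t) *
          Real.log ‖aeval (circleMap 0 1 t) (trigPoly (L + 1 : ℕ) n)‖ := by
    rw [hh, intervalIntegral.integral_const_mul]
    congr 1
    simp_rw [re_aeval_circleMap (natDegree_weightPoly_le L n), Finset.sum_mul, mul_assoc]
    rw [intervalIntegral.integral_finsetSum fun m _ => (hint m).const_mul _]
    refine Finset.sum_congr rfl fun m _ => ?_
    rw [intervalIntegral.integral_const_mul, coeff_weightPoly]
  rw [entropy, integral_entropyIntegrand_eq_integral_cos hl, e1,
    intervalIntegral.integral_comp_mul_left h two_ne_zero, mul_zero, e2, smul_eq_mul]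
  ring

theorem coeffD_zero (l : ℝ) (n : ℕ) : coeffD l n (0 : ℕ) = poch l n / (n ! : ℝ) := by
  have h := coeffD_add l 0 n
  rw [zero_add] at h
  rw [h, poch_zero]
  simp

theorem beta_zero (L n : ℕ) : beta (L + 1) n 0 = coeffD (L + 1 : ℕ) n (0 : ℕ) := by
  rw [← coeff_weightPoly, mul_coeff_zero, mul_coeff_zero, coeff_trigPoly, coeff_szegoPoly,
    alpha_zero]
  simp

theorem sum_Icc_one {M : Type*} [AddCommMonoid M] (f : ℕ → M) (N : ℕ) :
    ∑ m ∈ Finset.Icc 1 N, f m = ∑ m ∈ Finset.range N, f (m + 1) := by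
  rw [← Finset.Ico_add_one_right_eq_Icc, Finset.sum_Ico_eq_sum_range]
  exact Finset.sum_congr (by simp) fun m _ => by rw [add_comm]

theorem entropy_eq_waringSum (N n : ℕ) :
    entropy (N + 3 : ℕ) n = -(Real.pi / 2) * szegoC (N + 3 : ℕ) n *
      (2 * alpha (N + 3 : ℕ) n 0 * coeffD (N + 3 : ℕ) n 0 *
            Real.log (poch (N + 3 : ℕ) n / (n ! : ℝ))
          + alpha (N + 3 : ℕ) n 0 * coeffD (N + 3 : ℕ) n n
          + (2 * ((N + 3 : ℕ) : ℝ) - 1) *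
              ∑ m ∈ Finset.Icc 1 (n + (N + 3)), beta (N + 3) n m / (m : ℝ)
          - ∑ m ∈ Finset.Icc 1 (n + (N + 3)), beta (N + 3) n m * waringSum N n m) := by
  have hl : (1 : ℝ) ≤ (N + 3 : ℕ) := by exact_mod_cast Nat.le_add_left 1 (N + 2)
  have hl0 : (0 : ℝ) < (N + 3 : ℕ) := by positivity
  have hp : alpha (N + 3 : ℕ) n (N + 2) ≠ 0 := alpha_ne_zero (N + 2) n le_rfl
  have hd := coeffD_zero_pos hl0 n
  set D : PowerSeries ℝ := (trigPoly (N + 3 : ℕ) n : PowerSeries ℝ) with hD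
  have hD0 : PowerSeries.constantCoeff D ≠ 0 := by
    rw [← PowerSeries.coeff_zero_eq_constantCoeff_apply, hD, Polynomial.coeff_coe, coeff_trigPoly]
    exact hd.ne'
  set E := PowerSeries.derivative ℝ D * D⁻¹ with hE
  have hE' : PowerSeries.derivative ℝ D = D * E := by
    rw [hE, mul_left_comm, PowerSeries.mul_inv_cancel _ hD0, mul_one]
  have hI := fun m => integral_cos_mul_log_norm_aeval
    (fun z hz => aeval_trigPoly_ne_zero hl n hz) hE' m
  have hterm : ∀ m ∈ Finset.range (n + (N + 3)), beta (N + 3) n (m + 1) *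
      ∫ t in (0 : ℝ)..2 * Real.pi, Real.cos ((m + 1 : ℕ) * t) *
        Real.log ‖aeval (circleMap 0 1 t) (trigPoly (N + 3 : ℕ) n)‖ =
      Real.pi * ((2 * ((N + 3 : ℕ) : ℝ) - 1) * (beta (N + 3) n (m + 1) / (m + 1 : ℕ))
        - beta (N + 3) n (m + 1) * waringSum N n (m + 1)
        - if m = n + N + 2 then beta (N + 3) n (m + 1) / alpha (N + 3 : ℕ) n (N + 2) else 0) := by
    intro m hm
    rw [Finset.mem_range] at hm
    rw [(hI m).1, coeff_logDeriv_trigPoly N n hE' (by omega)]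
    have hm0 : (m : ℝ) + 1 ≠ 0 := by positivity
    push_cast
    split_ifs
    · field_simp
    · field_simp
      ring
  -- The α_(λ-1) in this β cancels the denominator of the correction at m = n + λ, which leaves d_n.
  have hlast : beta (N + 3) n (n + N + 2 + 1) = -(alpha (N + 3 : ℕ) n (N + 2) *
      coeffD (N + 3 : ℕ) n n) := by
    rw [beta, if_pos (by ring)]
    rfl
  have hmain := entropy_eq_sum (N + 2) n
  rw [show N + 2 + 1 = N + 3 by rfl] at hmain
  rw [hmain, Finset.sum_range_succ', Finset.sum_congr rfl hterm, ← Finset.mul_sum,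
    Finset.sum_sub_distrib, Finset.sum_sub_distrib, Finset.sum_ite_eq', if_pos (by simp; omega),
    hlast, ← Finset.mul_sum, sum_Icc_one, sum_Icc_one, alpha_zero]
  -- The frequency-zero term, 2π log d_0 with d_0 = (λ)_n/n!, gives the logarithm in the formula.
  have h0 := (hI 0).2
  rw [coeff_trigPoly, abs_of_pos hd, coeffD_zero] at h0
  have hb : beta (N + 3) n 0 = coeffD (N + 3 : ℕ) n (0 : ℕ) := beta_zero (N + 2) n
  simp only [Nat.cast_zero, zero_mul, Real.cos_zero, one_mul] at hb ⊢
  rw [h0, hb, neg_div, mul_div_cancel_left₀ _ hp]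
  ring

end GegenbauerEntropy

/-- In the innermost sum the family `κ` stands for the indices `k_6, k_8, …, k_{2(lam-1)}`, with
`κ i = k_{2j}` for `j = i + 3`, each ranging over `0 ≤ k_{2j} ≤ ⌊m / j⌋`. -/
theorem mainTheorem2 (lam n : ℕ) (hlam : 4 ≤ lam) :
    IntervalIntegrable (entropyIntegrand (lam : ℝ) n) MeasureTheory.volume (-1) 1 ∧
    entropy (lam : ℝ) n =
      -(Real.pi / 2) * szegoC lam n *
        (2 * alpha lam n 0 * coeffD lam n 0 *
            Real.log (poch lam n / (n ! : ℝ))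
          + alpha lam n 0 * coeffD lam n n
          + (2 * (lam : ℝ) - 1) *
              ∑ m ∈ Finset.Icc 1 (n + lam), beta lam n m / (m : ℝ)
          - ∑ m ∈ Finset.Icc 1 (n + lam), ∑ k ∈ Finset.Icc 1 m,
              ∑ κ ∈ Fintype.piFinset
                  (fun i : Fin (lam - 3) => Finset.Icc 0 (m / ((i : ℕ) + 3))),
                beta lam n m
                * (alpha lam n (lam - 3)
                    / alpha lam n (lam - 2)) ^ m
                * (-(alpha lam n (lam - 2) ^ 2
                    / (alpha lam n (lam - 1)
                      * alpha lam n (lam - 3)))) ^ k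
                * ((((k - 1)! : ℕ) : ℝ)
                    * invFact
                        (2 * (k : ℤ) - m + ∑ i : Fin (lam - 3), ((i : ℕ) + 1 : ℤ) * (κ i : ℤ))
                    * invFact
                        ((m : ℤ) - k - ∑ i : Fin (lam - 3), ((i : ℕ) + 2 : ℤ) * (κ i : ℤ)))
                * ∏ i : Fin (lam - 3),
                    1 / ((κ i)! : ℝ)
                      * (alpha lam n (lam - 1 - ((i : ℕ) + 3))
                          * alpha lam n (lam - 2) ^ ((i : ℕ) + 1)
                          / alpha lam n (lam - 3) ^ ((i : ℕ) + 2)) ^ κ i) := by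
  obtain ⟨N, rfl⟩ : ∃ N, lam = N + 3 := ⟨lam - 3, by omega⟩
  have hl : (1 : ℝ) ≤ (N + 3 : ℕ) := by exact_mod_cast Nat.le_add_left 1 (N + 2)
  refine ⟨(continuous_entropyIntegrand hl n).intervalIntegrable _ _, ?_⟩
  rw [entropy_eq_waringSum]
  congr 2
  -- It remains to move β_m inside the two inner sums.
  refine Finset.sum_congr rfl fun m _ => ?_
  rw [waringSum, Finset.mul_sum]
  refine Finset.sum_congr rfl fun k _ => ?_
  rw [Finset.mul_sum]
  refine Finset.sum_congr rfl fun κ _ => ?_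
  simp only [← mul_assoc]
  rfl
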